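/- Let $\nu$ be a finite Borel measure on $(0,1)$ and let $\Lambda$ denote Lebesgue measure. Let $H_0^1(0,1)$ be the space of functions $f:[0,1]\to\mathbb R$ with $f(0)=f(1)=0$ for which there is $\nabla f\in L^2_\Lambda([0,1])$ with $f(x)=f(0)+\int_0^x\nabla f\,d\Lambda$ for all $x\in[0,1]$. Let $\operatorname{dom}(\mathcal E_\nu)$ be the set of all $f\in H_0^1(0,1)$ that are affine linear on each connected component of $[0,1]\setminus\operatorname{supp}\nu$, and set $\mathcal E_\nu(f,g)=\int_0^1\nabla f\,\nabla g\,d\Lambda$ for $f,g\in\operatorname{dom}(\mathcal E_\nu)$. A real number $\lambda$ is an eigenvalue of $\mathcal E_\nu$ if there is $f\in\operatorname{dom}(\mathcal E_\nu)\setminus\{0\}$ with $\mathcal E_\nu(f,g)=\lambda\int fg\,d\nu$ for all $g\in\operatorname{dom}(\mathcal E_\nu)$. Let $N_\nu(x)$ be the number of eigenvalues not exceeding $x$, counted with multiplicity, and define the lower and upper spectral dimension of $\nu$ by $$\underline s_\nu=\liminf_{x\to\infty}\frac{\log N_\nu(x)}{\log x},\qquad \overline s_\nu=\limsup_{x\to\infty}\frac{\log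 N_\nu(x)}{\log x}.$$ If they coincide, the common value is denoted by $s_\nu$ and the spectral dimension is said to exist. For $q\in\mathbb R$ the $L^q$-spectrum of $\nu$ is $$\beta_\nu(q)=\limsup_{n\to\infty}\beta_n^\nu(q),\qquad \beta_n^\nu(q)=\frac1{\log 2^n}\log\sum_{C\in\mathcal D_{\nu,n}}\nu(C)^q,$$ where $\mathcal D_{\nu,n}$ is the set of those intervals $((k-1)2^{-n},k2^{-n}]$, $1\le k\le 2^n$, that have positive $\nu$-measure. (Logarithms, limits superior and limits inferior are taken in $[-\infty,\infty]$, with $\log 0=-\infty$.) Then the following hold. 1. If $\overline s_\nu=1/2$, then $\beta_\nu(q)=1-q$ for all $q\in[0,1]$. 2. If for some $q\in(0,1)$ the limit $\lim_{n\to\infty}\beta_n^\nu(q)$ exists and $\beta_\nu(q)=\lim_{n\to\infty}\beta_n^\nu(q)=1-q$, then $\beta_\nu(p)=1-p$ for all $p\in[0,1]$, and the spectral dimension exists with $s_\nu=1/2$. -/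

import Mathlib

open MeasureTheory Set Filter
open scoped Topology ENNReal

noncomputable section

namespace KreinFeller

/-! ### The Sobolev space on `[0,1]`

A function on `[0,1]` that vanishes at both endpoints is represented by its extension by zero to
the whole real line. -/

/-- `u` is a weak derivative of `f` on `[0,1]`: it is square integrable on `[0,1]` with respect
to Lebesgue measure and `f x = f 0 + ∫_0^x u` for `x ∈ [0,1]`. -/
def IsWeakDeriv (f u : ℝ → ℝ) : Prop :=
  MemLp u 2 (volume.restrict (Icc 0 1)) ∧
    ∀ x ∈ Icc (0 : ℝ) 1, f x = f 0 + ∫ t in (0 : ℝ)..x, u t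

theorem IsWeakDeriv.intervalIntegrable {f u : ℝ → ℝ} (h : IsWeakDeriv f u) {x : ℝ}
    (hx : x ∈ Icc (0 : ℝ) 1) : IntervalIntegrable u volume 0 x := by
  have h1 : IntegrableOn u (Icc 0 1) := h.1.integrable (by norm_num)
  rw [intervalIntegrable_iff_integrableOn_Icc_of_le hx.1]
  exact h1.mono_set (Icc_subset_Icc_right hx.2)

theorem IsWeakDeriv.add {f g u v : ℝ → ℝ} (hf : IsWeakDeriv f u) (hg : IsWeakDeriv g v) :
    IsWeakDeriv (f + g) (u + v) := by
  refine ⟨hf.1.add hg.1, fun x hx => ?_⟩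
  have := intervalIntegral.integral_add (hf.intervalIntegrable hx) (hg.intervalIntegrable hx)
  simp only [Pi.add_apply, this, hf.2 x hx, hg.2 x hx]
  ring

theorem IsWeakDeriv.smul {f u : ℝ → ℝ} (c : ℝ) (hf : IsWeakDeriv f u) :
    IsWeakDeriv (c • f) (c • u) := by
  refine ⟨hf.1.const_smul c, fun x hx => ?_⟩
  simp only [Pi.smul_apply, smul_eq_mul, intervalIntegral.integral_const_mul, hf.2 x hx]
  ring

theorem IsWeakDeriv.zero : IsWeakDeriv 0 0 :=
  ⟨MemLp.zero, fun x _ => by simp⟩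

theorem IsWeakDeriv.continuousOn {f u : ℝ → ℝ} (h : IsWeakDeriv f u) :
    ContinuousOn f (Icc 0 1) := by
  have h1 : IntegrableOn u (Icc 0 1) := h.1.integrable (by norm_num)
  have h2 := intervalIntegral.continuousOn_primitive_interval (a := (0 : ℝ)) (b := 1) (f := u)
    (μ := volume) (by rwa [uIcc_of_le zero_le_one])
  rw [uIcc_of_le zero_le_one] at h2
  exact (continuousOn_const.add h2).congr h.2

theorem IsWeakDeriv.ae_unique {f u v : ℝ → ℝ} (hu : IsWeakDeriv f u) (hv : IsWeakDeriv f v) :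
    u =ᵐ[volume.restrict (Icc 0 1)] v := by
  have h01 : (1 : ℝ) ∈ Icc (0 : ℝ) 1 := by simp
  have hU := (hu.intervalIntegrable h01).ae_hasDerivAt_integral
  have hV := (hv.intervalIntegrable h01).ae_hasDerivAt_integral
  rw [Filter.EventuallyEq, ← restrict_Ioo_eq_restrict_Icc, ae_restrict_iff' measurableSet_Ioo]
  filter_upwards [hU, hV] with x hxU hxV hx
  have hx' : x ∈ uIcc (0 : ℝ) 1 := by
    rw [uIcc_of_le zero_le_one]; exact Ioo_subset_Icc_self hx
  have h0 : (0 : ℝ) ∈ uIcc (0 : ℝ) 1 := by simp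
  refine (hxU hx' 0 h0).unique ((hxV hx' 0 h0).congr_of_eventuallyEq ?_)
  filter_upwards [Ioo_mem_nhds hx.1 hx.2] with y hy
  have := hu.2 y (Ioo_subset_Icc_self hy)
  have := hv.2 y (Ioo_subset_Icc_self hy)
  linarith

open Classical in
/-- The weak derivative of `f` on `[0,1]`, which is unique up to a Lebesgue null set
(and `0` if there is none). -/
def weakDeriv (f : ℝ → ℝ) : ℝ → ℝ :=
  if h : ∃ u, IsWeakDeriv f u then h.choose else 0

theorem isWeakDeriv_weakDeriv {f : ℝ → ℝ} (h : ∃ u, IsWeakDeriv f u) :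
    IsWeakDeriv f (weakDeriv f) := by
  rw [weakDeriv, dif_pos h]; exact h.choose_spec

/-- The Sobolev space `H_0^1(0,1)`. -/
def H10 : Submodule ℝ (ℝ → ℝ) where
  carrier := {f | (∀ x ∉ Ioo (0 : ℝ) 1, f x = 0) ∧ ∃ u, IsWeakDeriv f u}
  zero_mem' := ⟨fun _ _ => rfl, 0, IsWeakDeriv.zero⟩
  add_mem' := by
    rintro f g ⟨hf, u, hu⟩ ⟨hg, v, hv⟩
    exact ⟨fun x hx => by simp [hf x hx, hg x hx], u + v, hu.add hv⟩
  smul_mem' := by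
    rintro c f ⟨hf, u, hu⟩
    exact ⟨fun x hx => by simp [hf x hx], c • u, hu.smul c⟩

/-- `C_ν([0,1])`: the functions that are continuous on `[0,1]` and affine linear on each
connected component of `[0,1] \ supp ν`. -/
def CNu (ν : Measure ℝ) : Submodule ℝ (ℝ → ℝ) where
  carrier := {f | ContinuousOn f (Icc 0 1) ∧ ∀ x ∈ Icc (0 : ℝ) 1 \ ν.support,
    ∃ c d : ℝ, ∀ y ∈ connectedComponentIn (Icc (0 : ℝ) 1 \ ν.support) x, f y = c * y + d}
  zero_mem' := ⟨continuousOn_const, fun _ _ => ⟨0, 0, fun _ _ => by simp⟩⟩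
  add_mem' := by
    rintro f g ⟨hf, hf'⟩ ⟨hg, hg'⟩
    refine ⟨hf.add hg, fun x hx => ?_⟩
    obtain ⟨c, d, h⟩ := hf' x hx
    obtain ⟨c', d', h'⟩ := hg' x hx
    exact ⟨c + c', d + d', fun y hy => by simp only [Pi.add_apply, h y hy, h' y hy]; ring⟩
  smul_mem' := by
    rintro a f ⟨hf, hf'⟩
    refine ⟨hf.const_smul a, fun x hx => ?_⟩
    obtain ⟨c, d, h⟩ := hf' x hx
    exact ⟨a * c, a * d, fun y hy => by
      simp only [Pi.smul_apply, smul_eq_mul, h y hy]; ring⟩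

/-! ### The form and its eigenvalues -/

/-- The domain `H_0^1(0,1) ∩ C_ν([0,1])` of the Dirichlet form. -/
def formDomain (ν : Measure ℝ) : Submodule ℝ (ℝ → ℝ) := H10 ⊓ CNu ν

/-- The form `(f, g) ↦ ∫_0^1 ∇f ∇g`. -/
def energy (f g : ℝ → ℝ) : ℝ := ∫ t in (0 : ℝ)..1, weakDeriv f t * weakDeriv g t

/-- The inner product of `L²(ν)`. -/
def innerNu (ν : Measure ℝ) (f g : ℝ → ℝ) : ℝ := ∫ t, f t * g t ∂ν

/-- The energy can be computed from arbitrary weak derivatives. -/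
theorem energy_eq {f g u v : ℝ → ℝ} (hu : IsWeakDeriv f u) (hv : IsWeakDeriv g v) :
    energy f g = ∫ t in (0 : ℝ)..1, u t * v t := by
  have h1 := (isWeakDeriv_weakDeriv ⟨u, hu⟩).ae_unique hu
  have h2 := (isWeakDeriv_weakDeriv ⟨v, hv⟩).ae_unique hv
  rw [energy, intervalIntegral.integral_of_le zero_le_one,
    intervalIntegral.integral_of_le zero_le_one, ← integral_Icc_eq_integral_Ioc,
    ← integral_Icc_eq_integral_Ioc]
  exact integral_congr_ae (h1.mul h2)

theorem IsWeakDeriv.mul_intervalIntegrable {f g u v : ℝ → ℝ} (hu : IsWeakDeriv f u)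
    (hv : IsWeakDeriv g v) : IntervalIntegrable (fun t => u t * v t) volume 0 1 := by
  rw [intervalIntegrable_iff_integrableOn_Icc_of_le zero_le_one]
  exact hu.1.integrable_mul hv.1

theorem energy_add_left {f f' g : ℝ → ℝ} (hf : f ∈ H10) (hf' : f' ∈ H10) (hg : g ∈ H10) :
    energy (f + f') g = energy f g + energy f' g := by
  obtain ⟨-, u, hu⟩ := hf
  obtain ⟨-, u', hu'⟩ := hf'
  obtain ⟨-, v, hv⟩ := hg
  rw [energy_eq (hu.add hu') hv, energy_eq hu hv, energy_eq hu' hv,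
    ← intervalIntegral.integral_add (hu.mul_intervalIntegrable hv)
      (hu'.mul_intervalIntegrable hv)]
  simp only [Pi.add_apply, add_mul]

theorem energy_smul_left {f g : ℝ → ℝ} (c : ℝ) (hf : f ∈ H10) (hg : g ∈ H10) :
    energy (c • f) g = c * energy f g := by
  obtain ⟨-, u, hu⟩ := hf
  obtain ⟨-, v, hv⟩ := hg
  rw [energy_eq (hu.smul c) hv, energy_eq hu hv, ← intervalIntegral.integral_const_mul]
  simp only [Pi.smul_apply, smul_eq_mul, mul_assoc]

theorem integrable_mul (ν : Measure ℝ) [IsFiniteMeasure ν] {f g : ℝ → ℝ}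
    (hf : f ∈ H10) (hg : g ∈ H10) : Integrable (fun t => f t * g t) ν := by
  obtain ⟨hf0, u, hu⟩ := hf
  obtain ⟨-, v, hv⟩ := hg
  have h : IntegrableOn (fun t => f t * g t) (Icc 0 1) ν :=
    (hu.continuousOn.mul hv.continuousOn).integrableOn_compact isCompact_Icc
  refine (integrableOn_iff_integrable_of_support_subset fun x hx => ?_).1 h
  by_contra hx'
  exact hx (by simp [hf0 x fun h => hx' (Ioo_subset_Icc_self h)])

/-- The space of all `f` in the domain with `E(f, g) = lam ⟨f, g⟩_ν` for all `g` in the domain;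
its nonzero elements are the eigenfunctions with eigenvalue `lam`. -/
def eigenspace (ν : Measure ℝ) [IsFiniteMeasure ν] (lam : ℝ) : Submodule ℝ (ℝ → ℝ) where
  carrier := {f | f ∈ formDomain ν ∧
    ∀ g ∈ formDomain ν, energy f g = lam * innerNu ν f g}
  zero_mem' := ⟨zero_mem _, fun g hg => by
    have := energy_smul_left 0 (zero_mem H10) hg.1
    simpa [innerNu] using this⟩
  add_mem' := by
    rintro f f' ⟨hf, h⟩ ⟨hf', h'⟩
    refine ⟨add_mem hf hf', fun g hg => ?_⟩
    have : innerNu ν (f + f') g = innerNu ν f g + innerNu ν f' g := by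
      simp only [innerNu, Pi.add_apply, add_mul]
      exact integral_add (integrable_mul ν hf.1 hg.1) (integrable_mul ν hf'.1 hg.1)
    rw [energy_add_left hf.1 hf'.1 hg.1, h g hg, h' g hg, this]
    ring
  smul_mem' := by
    rintro c f ⟨hf, h⟩
    refine ⟨Submodule.smul_mem _ c hf, fun g hg => ?_⟩
    have : innerNu ν (c • f) g = c * innerNu ν f g := by
      simp only [innerNu, Pi.smul_apply, smul_eq_mul, mul_assoc]
      exact integral_const_mul c _
    rw [energy_smul_left c hf.1 hg.1, h g hg, this]
    ring

/-- The multiplicity of `lam` (`0` if `lam` is not an eigenvalue). -/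
def multiplicity (ν : Measure ℝ) [IsFiniteMeasure ν] (lam : ℝ) : ℕ∞ :=
  Cardinal.toENat (Module.rank ℝ (eigenspace ν lam))

/-- The eigenvalue counting function: the number of eigenvalues not exceeding `x`, counted with
multiplicity. -/
def countingFunction (ν : Measure ℝ) [IsFiniteMeasure ν] (x : ℝ) : ℝ≥0∞ :=
  ∑' lam : Iic x, (multiplicity ν lam : ℝ≥0∞)

/-! ### Spectral dimensions

All logarithms and limits are taken in the extended real line, with `log 0 = -∞`. -/

/-- The lower spectral dimension. -/
def lowerSpectralDim (ν : Measure ℝ) [IsFiniteMeasure ν] : EReal :=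
  liminf (fun x : ℝ => ENNReal.log (countingFunction ν x) / (Real.log x : EReal)) atTop

/-- The upper spectral dimension. -/
def upperSpectralDim (ν : Measure ℝ) [IsFiniteMeasure ν] : EReal :=
  limsup (fun x : ℝ => ENNReal.log (countingFunction ν x) / (Real.log x : EReal)) atTop

/-- The spectral dimension of `ν` exists and equals `s`. -/
def HasSpectralDim (ν : Measure ℝ) [IsFiniteMeasure ν] (s : EReal) : Prop :=
  lowerSpectralDim ν = s ∧ upperSpectralDim ν = s

/-! ### The `L^q`-spectrum -/

/-- The dyadic interval `(k 2⁻ⁿ, (k+1) 2⁻ⁿ]`. -/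
def dyadic (n k : ℕ) : Set ℝ := Ioc ((k : ℝ) / 2 ^ n) (((k : ℝ) + 1) / 2 ^ n)

open Classical in
/-- `β_n(q)`; the sum runs over the dyadic intervals of level `n` in `(0,1]` that have positive
`ν`-measure. -/
def lqLevel (ν : Measure ℝ) (n : ℕ) (q : ℝ) : EReal :=
  ENNReal.log (∑ k ∈ (Finset.range (2 ^ n)).filter fun k => 0 < ν (dyadic n k),
    ν (dyadic n k) ^ q) / (Real.log (2 ^ n) : EReal)

/-- The `L^q`-spectrum `β_ν(q) = limsup_n β_n(q)`. -/
def lqSpectrum (ν : Measure ℝ) (q : ℝ) : EReal :=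
  limsup (fun n : ℕ => lqLevel ν n q) atTop

end KreinFeller

end

/-! The eigenvalues of the form are the inverses of the nonzero eigenvalues of the compact Green
operator on `L²([0,1])`, so the counting function is controlled by the min-max principle.

For an upper bound, stop at the first dyadic intervals whose mass times length is less than
`1 / (2x)`. By Poincaré's inequality a function vanishing at their left endpoints has Rayleigh
quotient greater than `x`, so their number bounds `N_ν(x)`, and Markov's inequality bounds that
number by the `L^q`-sums: a growth rate less than `q` of the sums at `q` gives the upper spectral
dimension the bound `q`. The sums have the trivial rates `1` at `q = 0` and `0` at `q = 1` and are
logarithmically convex in `q`, so the rate is at most `1 - q` on `[0, 1]`; a rate less than `1 - p`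
at a single `p` propagates to all of `(0, 1)` and pushes the upper spectral dimension below `1 / 2`.

For the lower bound, a rate `1 - q` along all scales forces, by Hölder's inequality, about `2ⁿ`
dyadic intervals of level `n` to have mass about `2⁻ⁿ`. Trapezoidal functions over every third of
them have disjoint supports and Rayleigh quotient about `4ⁿ`, so `N_ν(4ⁿ)` is about `2ⁿ`. -/

section CompactOperators

open Module Module.End
open scoped InnerProductSpace

variable {K : Type*} [NormedAddCommGroup K] [InnerProductSpace ℝ K]

theorem norm_sq_sum_of_pairwise_inner_eq_zero {ι : Type*} {s : Finset ι} {v : ι → K}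
    (h : (s : Set ι).Pairwise fun i j => ⟪v i, v j⟫_ℝ = 0) :
    ‖∑ i ∈ s, v i‖ ^ 2 = ∑ i ∈ s, ‖v i‖ ^ 2 := by
  rw [← real_inner_self_eq_norm_sq, sum_inner]
  refine Finset.sum_congr rfl fun i hi => ?_
  rw [inner_sum, Finset.sum_eq_single_of_mem i hi fun j hj hji => h hi hj hji.symm,
    real_inner_self_eq_norm_sq]

theorem iSup_eigenspace_ge_orthogonal_le [CompleteSpace K] {R : K →L[ℝ] K}
    (hR : IsCompactOperator R) (hs : (R : K →ₗ[ℝ] K).IsSymmetric) (δ : ℝ) :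
    (⨆ μ : Ici δ, eigenspace (R : K →ₗ[ℝ] K) μ)ᗮ ≤
      (⨆ μ : Iio δ, eigenspace (R : K →ₗ[ℝ] K) μ).topologicalClosure := by
  set W := ⨆ μ : Ici δ, eigenspace (R : K →ₗ[ℝ] K) μ
  set U := ⨆ μ : Iio δ, eigenspace (R : K →ₗ[ℝ] K) μ
  intro v hv
  have : CompleteSpace U.topologicalClosure :=
    U.isClosed_topologicalClosure.isComplete.completeSpace_coe
  obtain ⟨u, hu, w, hw, rfl⟩ := U.topologicalClosure.exists_add_mem_mem_orthogonal v
  have hUW : U ≤ Wᗮ := Submodule.isOrtho_iSup_left.2 fun μ => Submodule.isOrtho_iSup_right.2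
    fun μ' => hs.orthogonalFamily_eigenspaces.isOrtho (μ.2.trans_le μ'.2).ne
  have huW : u ∈ Wᗮ := U.topologicalClosure_minimal hUW W.isClosed_orthogonal hu
  have hwW : w ∈ Wᗮ := by simpa using sub_mem hv huW
  have hwU : w ∈ Uᗮ := Submodule.orthogonal_le U.le_topologicalClosure hw
  have hw0 : w ∈ (⨆ μ, eigenspace (R : K →ₗ[ℝ] K) μ)ᗮ := by
    have hwWU : w ∈ (W ⊔ U)ᗮ := W.inf_orthogonal U ▸ Submodule.mem_inf.2 ⟨hwW, hwU⟩
    refine Submodule.orthogonal_le (iSup_le fun μ => ?_) hwWU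
    rcases lt_or_ge μ δ with h | h
    · exact le_sup_of_le_right (le_iSup_of_le (⟨μ, h⟩ : Iio δ) le_rfl)
    · exact le_sup_of_le_left (le_iSup_of_le (⟨μ, h⟩ : Ici δ) le_rfl)
  rw [ContinuousLinearMap.orthogonalComplement_iSup_eigenspaces_eq_bot hR hs,
    Submodule.mem_bot] at hw0
  simpa [hw0] using hu

theorem inner_apply_le_of_mem_iSup_eigenspace_lt {R : K →ₗ[ℝ] K} (hs : R.IsSymmetric) {δ : ℝ}
    {v : K} (hv : v ∈ ⨆ μ : Iio δ, eigenspace R μ) : ⟪R v, v⟫_ℝ ≤ δ * ‖v‖ ^ 2 := by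
  obtain ⟨f, hf, rfl⟩ := (Submodule.mem_iSup_iff_exists_finsupp _ _).1 hv
  let g (μ : Iio δ) : eigenspace R (μ : ℝ) := ⟨f μ, hf μ⟩
  have hV := hs.orthogonalFamily_eigenspaces.comp (Subtype.val_injective (p := (· ∈ Iio δ)))
  have hRf : R (f.sum fun _ x => x) = ∑ μ ∈ f.support, (μ : ℝ) • f μ := by
    rw [Finsupp.sum, map_sum]
    exact Finset.sum_congr rfl fun μ _ => mem_eigenspace_iff.1 (hf μ)
  calc ⟪R (f.sum fun _ x => x), f.sum fun _ x => x⟫_ℝ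
      = ∑ μ ∈ f.support, (μ : ℝ) * ‖f μ‖ ^ 2 := by
        rw [hRf]
        refine (hV.inner_sum (fun μ => (μ : ℝ) • g μ) g f.support).trans ?_
        simp [g, real_inner_smul_left]
    _ ≤ ∑ μ ∈ f.support, δ * ‖f μ‖ ^ 2 := by
        gcongr with μ
        exact μ.2.le
    _ = δ * ‖f.sum fun _ x => x‖ ^ 2 := by
        rw [← Finset.mul_sum]
        exact congrArg (δ * ·) (hV.norm_sum g f.support).symm

theorem inner_apply_le_of_mem_iSup_eigenspace_ge_orthogonal [CompleteSpace K] {R : K →L[ℝ] K}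
    (hR : IsCompactOperator R) (hs : (R : K →ₗ[ℝ] K).IsSymmetric) {δ : ℝ} {v : K}
    (hv : v ∈ (⨆ μ : Ici δ, eigenspace (R : K →ₗ[ℝ] K) μ)ᗮ) : ⟪R v, v⟫_ℝ ≤ δ * ‖v‖ ^ 2 := by
  have hclosed : IsClosed {p : K | ⟪R p, p⟫_ℝ ≤ δ * ‖p‖ ^ 2} :=
    isClosed_le (by fun_prop) (by fun_prop)
  exact closure_minimal (fun p hp => inner_apply_le_of_mem_iSup_eigenspace_lt hs hp) hclosed
    (iSup_eigenspace_ge_orthogonal_le hR hs δ hv)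

theorem finrank_le_tsum_finrank_eigenspace [CompleteSpace K] {R : K →L[ℝ] K}
    (hR : IsCompactOperator R) (hs : (R : K →ₗ[ℝ] K).IsSymmetric) {δ : ℝ} (hδ : 0 < δ)
    {V : Type*} [AddCommGroup V] [Module ℝ V] [FiniteDimensional ℝ V] (φ : V →ₗ[ℝ] K)
    (hφ : ∀ c, c ≠ 0 → δ * ‖φ c‖ ^ 2 < ⟪R (φ c), φ c⟫_ℝ) :
    (finrank ℝ V : ℝ≥0∞) ≤
      ∑' μ : Ici δ, (finrank ℝ (eigenspace (R : K →ₗ[ℝ] K) μ) : ℝ≥0∞) := by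
  let W (μ : Ici δ) := eigenspace (R : K →ₗ[ℝ] K) μ
  have hfd (μ : Ici δ) : FiniteDimensional ℝ (W μ) :=
    ContinuousLinearMap.finite_dimensional_eigenspace hR _ (hδ.trans_le μ.2).ne'
  by_contra! hlt
  have hfin := ENNReal.finite_const_le_of_tsum_ne_top hlt.ne_top one_ne_zero
  set S := hfin.toFinset with hS
  have hsum : ∑ μ ∈ S, finrank ℝ (W μ) < finrank ℝ V := by
    exact_mod_cast (ENNReal.sum_le_tsum S).trans_lt hlt
  let Φ : V →ₗ[ℝ] ∀ μ : S, W μ :=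
    LinearMap.pi fun μ => ((W μ).orthogonalProjectionOnto : K →ₗ[ℝ] W μ) ∘ₗ φ
  have hker : Φ.ker ≠ ⊥ := by
    apply LinearMap.ker_ne_bot_of_finrank_lt
    rwa [finrank_pi_fintype, Finset.sum_coe_sort S fun μ => finrank ℝ (W μ)]
  obtain ⟨c, hc, hc0⟩ := Submodule.exists_mem_ne_zero_of_ne_bot hker
  refine (hφ c hc0).not_ge (inner_apply_le_of_mem_iSup_eigenspace_ge_orthogonal hR hs ?_)
  rw [← Submodule.iInf_orthogonal, Submodule.mem_iInf]
  intro μ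
  by_cases hμ : μ ∈ S
  · have h0 : (W μ).orthogonalProjectionOnto (φ c) = 0 :=
      congrFun (LinearMap.mem_ker.1 hc) ⟨μ, hμ⟩
    exact Submodule.orthogonalProjectionOnto_eq_zero_iff.1 h0
  · have h0 : finrank ℝ (W μ) = 0 := by
      rw [hS, Set.Finite.mem_toFinset] at hμ
      simpa using hμ
    have hbot : W μ = ⊥ := Submodule.finrank_eq_zero.1 h0
    change φ c ∈ (W μ)ᗮ
    simp [hbot]

theorem isCompactOperator_of_forall_small_on_ker {𝕜 H E : Type*} [RCLike 𝕜]
    [NormedAddCommGroup H] [InnerProductSpace 𝕜 H] [CompleteSpace H] [NormedAddCommGroup E]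
    [NormedSpace 𝕜 E] [CompleteSpace E] {J : H →L[𝕜] E}
    (h : ∀ ε > 0, ∃ (n : ℕ) (B : H →L[𝕜] (Fin n → 𝕜)), ∀ u, B u = 0 → ‖J u‖ ≤ ε * ‖u‖) :
    IsCompactOperator J := by
  suffices hJ : J ∈ closure {f : H →L[𝕜] E | IsCompactOperator f} by
    rwa [isClosed_setOfPred_isCompactOperator.closure_eq] at hJ
  refine Metric.mem_closure_iff.2 fun ε hε => ?_
  obtain ⟨n, B, hB⟩ := h (ε / 2) (by positivity)
  set Z : Submodule 𝕜 H := (B : H →ₗ[𝕜] (Fin n → 𝕜)).ker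
  have : CompleteSpace Z := B.isClosed_ker.isComplete.completeSpace_coe
  have hinj : Function.Injective ((B : H →ₗ[𝕜] (Fin n → 𝕜)).domRestrict Zᗮ) := by
    refine (injective_iff_map_eq_zero _).2 fun z hz => Subtype.ext ?_
    exact inner_self_eq_zero (𝕜 := 𝕜).1 (z.2 z (LinearMap.mem_ker.2 hz))
  have hfd : FiniteDimensional 𝕜 Zᗮ := FiniteDimensional.of_injective _ hinj
  have : ProperSpace Zᗮ := FiniteDimensional.proper 𝕜 Zᗮ
  refine ⟨(J ∘L Zᗮ.subtypeL) ∘L Zᗮ.orthogonalProjectionOnto,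
    (isCompactOperator_of_locallyCompactSpace_rng (J ∘L Zᗮ.subtypeL)).comp_clm
      Zᗮ.orthogonalProjectionOnto, ?_⟩
  rw [dist_eq_norm]
  refine (ContinuousLinearMap.opNorm_le_bound _ (by positivity) fun u => ?_).trans_lt
    (half_lt_self hε)
  have hsub : (J - (J ∘L Zᗮ.subtypeL) ∘L Zᗮ.orthogonalProjectionOnto) u =
      J (Z.starProjection u) := by
    conv_lhs => rw [← Z.starProjection_add_starProjection_orthogonal u]
    simp
  calc ‖(J - (J ∘L Zᗮ.subtypeL) ∘L Zᗮ.orthogonalProjectionOnto) u‖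
      ≤ ε / 2 * ‖Z.starProjection u‖ :=
        hsub ▸ hB _ (LinearMap.mem_ker.1 (Z.starProjection_apply_mem u))
    _ ≤ ε / 2 * ‖u‖ := by gcongr; exact Z.norm_starProjection_apply_le u

end CompactOperators

noncomputable section

namespace KreinFeller

section WeakDerivatives

theorem IsWeakDeriv.integrableOn {f u : ℝ → ℝ} (h : IsWeakDeriv f u) :
    IntegrableOn u (Icc 0 1) :=
  h.1.integrable (by norm_num)

theorem IsWeakDeriv.integrableOn_sq {f u : ℝ → ℝ} (h : IsWeakDeriv f u) :
    IntegrableOn (fun t => u t ^ 2) (Icc 0 1) :=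
  h.1.integrable_sq

theorem intervalIntegrable_of_integrableOn_Icc {u : ℝ → ℝ} {a b c d : ℝ}
    (hu : IntegrableOn u (Icc a b)) (hc : c ∈ Icc a b) (hd : d ∈ Icc a b) :
    IntervalIntegrable u volume c d :=
  (hu.mono_set (uIcc_subset_Icc hc hd)).intervalIntegrable

theorem sq_integral_le {u : ℝ → ℝ} {a b : ℝ} (hab : a ≤ b) (hu : IntervalIntegrable u volume a b)
    (hu2 : IntervalIntegrable (fun t => u t ^ 2) volume a b) :
    (∫ t in a..b, u t) ^ 2 ≤ (b - a) * ∫ t in a..b, u t ^ 2 := by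
  rcases hab.eq_or_lt with rfl | hlt
  · simp
  have hba : 0 < b - a := sub_pos.2 hlt
  set m := (∫ t in a..b, u t) / (b - a)
  have hm : ∫ t in a..b, u t = m * (b - a) := (div_mul_cancel₀ _ hba.ne').symm
  have hvar : ∫ t in a..b, (u t - m) ^ 2 = (∫ t in a..b, u t ^ 2) - m ^ 2 * (b - a) := by
    have hexp : ∀ t, (u t - m) ^ 2 = u t ^ 2 - (2 * m) * u t + m ^ 2 := fun t => by ring
    simp only [hexp]
    rw [intervalIntegral.integral_add (hu2.sub (hu.const_mul _)) (by simp),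
      intervalIntegral.integral_sub hu2 (hu.const_mul _), intervalIntegral.integral_const_mul,
      intervalIntegral.integral_const, hm, smul_eq_mul]
    ring
  have hnonneg : 0 ≤ ∫ t in a..b, (u t - m) ^ 2 :=
    intervalIntegral.integral_nonneg hab fun t _ => sq_nonneg _
  rw [hm]
  nlinarith

theorem IsWeakDeriv.sub_eq_integral {f u : ℝ → ℝ} (h : IsWeakDeriv f u) {a b : ℝ}
    (ha : a ∈ Icc (0 : ℝ) 1) (hb : b ∈ Icc (0 : ℝ) 1) : f b - f a = ∫ t in a..b, u t := by
  rw [h.2 a ha, h.2 b hb, ← intervalIntegral.integral_interval_sub_left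
    (h.intervalIntegrable hb) (h.intervalIntegrable ha)]
  ring

theorem IsWeakDeriv.integral_eq_zero_of_mem_H10 {f u : ℝ → ℝ} (h : IsWeakDeriv f u)
    (hf : f ∈ H10) : ∫ t in (0 : ℝ)..1, u t = 0 := by
  rw [← h.sub_eq_integral (by simp) (by simp), hf.1 0 (by simp), hf.1 1 (by simp), sub_zero]

theorem IsWeakDeriv.sq_sub_le {f u : ℝ → ℝ} (h : IsWeakDeriv f u) {a b c : ℝ} (ha : 0 ≤ a)
    (hab : a ≤ b) (hbc : b ≤ c) (hc : c ≤ 1) :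
    (f b - f a) ^ 2 ≤ (b - a) * ∫ t in a..c, u t ^ 2 := by
  have ha' : a ∈ Icc (0 : ℝ) 1 := ⟨ha, hab.trans (hbc.trans hc)⟩
  have hb' : b ∈ Icc (0 : ℝ) 1 := ⟨ha.trans hab, hbc.trans hc⟩
  have hc' : c ∈ Icc (0 : ℝ) 1 := ⟨hb'.1.trans hbc, hc⟩
  calc (f b - f a) ^ 2 = (∫ t in a..b, u t) ^ 2 := by rw [h.sub_eq_integral ha' hb']
    _ ≤ (b - a) * ∫ t in a..b, u t ^ 2 :=
      sq_integral_le hab (intervalIntegrable_of_integrableOn_Icc h.integrableOn ha' hb')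
        (intervalIntegrable_of_integrableOn_Icc h.integrableOn_sq ha' hb')
    _ ≤ (b - a) * ∫ t in a..c, u t ^ 2 := by
      refine mul_le_mul_of_nonneg_left ?_ (sub_nonneg.2 hab)
      exact intervalIntegral.integral_mono_interval le_rfl hab hbc
        (Eventually.of_forall fun t => sq_nonneg (u t))
        (intervalIntegrable_of_integrableOn_Icc h.integrableOn_sq ha' hc')

theorem integral_congr_ae_unit {u v : ℝ → ℝ} (h : u =ᵐ[volume.restrict (Icc (0 : ℝ) 1)] v) {x : ℝ}
    (hx : x ∈ Icc (0 : ℝ) 1) : ∫ t in (0 : ℝ)..x, u t = ∫ t in (0 : ℝ)..x, v t := by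
  rw [intervalIntegral.integral_of_le hx.1, intervalIntegral.integral_of_le hx.1]
  exact integral_congr_ae (ae_restrict_of_ae_restrict_of_subset
    (Ioc_subset_Icc_self.trans (Icc_subset_Icc_right hx.2)) h)

theorem IsWeakDeriv.congr_ae {f u v : ℝ → ℝ} (h : IsWeakDeriv f u)
    (huv : u =ᵐ[volume.restrict (Icc (0 : ℝ) 1)] v) : IsWeakDeriv f v :=
  ⟨(memLp_congr_ae huv).1 h.1, fun x hx => by rw [h.2 x hx, integral_congr_ae_unit huv hx]⟩

/-- The Hilbert space `L²([0,1])` in which weak derivatives live. -/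
abbrev UnitL2 : Type := Lp ℝ 2 (volume.restrict (Icc (0 : ℝ) 1))

theorem UnitL2.inner_eq (u v : UnitL2) : inner ℝ u v = ∫ t in (0 : ℝ)..1, u t * v t := by
  rw [L2.inner_def, intervalIntegral.integral_of_le zero_le_one, ← integral_Icc_eq_integral_Ioc]
  simp [mul_comm]

/-- The weak derivative as a linear map from `H_0^1(0,1)` to `L²([0,1])`; the energy is the
pullback of the inner product along it. -/
def grad : H10 →ₗ[ℝ] UnitL2 where
  toFun f := (isWeakDeriv_weakDeriv f.2.2).1.toLp
  map_add' f g := by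
    rw [← MemLp.toLp_add]
    exact MemLp.toLp_congr _ _ ((isWeakDeriv_weakDeriv (f + g).2.2).ae_unique
      ((isWeakDeriv_weakDeriv f.2.2).add (isWeakDeriv_weakDeriv g.2.2)))
  map_smul' c f := by
    rw [← MemLp.toLp_const_smul]
    exact MemLp.toLp_congr _ _ ((isWeakDeriv_weakDeriv (c • f).2.2).ae_unique
      ((isWeakDeriv_weakDeriv f.2.2).smul c))

theorem isWeakDeriv_grad (f : H10) : IsWeakDeriv f (grad f) :=
  have h := isWeakDeriv_weakDeriv f.2.2
  h.congr_ae h.1.coeFn_toLp.symm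

theorem inner_grad (f g : H10) : inner ℝ (grad f) (grad g) = energy f g := by
  rw [UnitL2.inner_eq, energy_eq (isWeakDeriv_grad f) (isWeakDeriv_grad g)]

theorem norm_grad_sq (f : H10) : ‖grad f‖ ^ 2 = energy f f := by
  rw [← inner_grad, real_inner_self_eq_norm_sq]

theorem energy_self_eq {f u : ℝ → ℝ} (hu : IsWeakDeriv f u) :
    energy f f = ∫ t in (0 : ℝ)..1, u t ^ 2 := by
  simp only [energy_eq hu hu, sq]

theorem integral_grad (f : H10) : ∫ t in (0 : ℝ)..1, grad f t = 0 :=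
  (isWeakDeriv_grad f).integral_eq_zero_of_mem_H10 f.2

theorem sq_sub_le_mul_norm_grad_sq (f : H10) {a b : ℝ} (ha : 0 ≤ a) (hab : a ≤ b) (hb : b ≤ 1) :
    ((f : ℝ → ℝ) b - (f : ℝ → ℝ) a) ^ 2 ≤ (b - a) * ‖grad f‖ ^ 2 := by
  have hu := isWeakDeriv_grad f
  refine (hu.sq_sub_le ha hab le_rfl hb).trans (mul_le_mul_of_nonneg_left ?_ (sub_nonneg.2 hab))
  rw [norm_grad_sq, energy_self_eq hu]
  exact intervalIntegral.integral_mono_interval ha hab hb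
    (Eventually.of_forall fun t => sq_nonneg (grad f t))
    (intervalIntegrable_of_integrableOn_Icc hu.integrableOn_sq (by simp) (by simp))

theorem abs_apply_le_norm_grad (f : H10) (x : ℝ) : |(f : ℝ → ℝ) x| ≤ ‖grad f‖ := by
  by_cases hx : x ∈ Ioo (0 : ℝ) 1
  · refine abs_le_of_sq_le_sq ?_ (norm_nonneg _)
    have h := sq_sub_le_mul_norm_grad_sq f le_rfl hx.1.le hx.2.le
    rw [f.2.1 0 (by simp), sub_zero, sub_zero] at h
    exact h.trans (mul_le_of_le_one_left (sq_nonneg _) hx.2.le)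
  · rw [f.2.1 x hx, abs_zero]
    exact norm_nonneg _

theorem grad_injective : Function.Injective grad :=
  (injective_iff_map_eq_zero _).2 fun f hf => Subtype.ext <| funext fun x => by
    simpa [hf] using abs_apply_le_norm_grad f x

/-- The primitive of `u - ∫ u` on `[0,1]`, extended by zero. -/
def meanFreePrimitive (u : ℝ → ℝ) : ℝ → ℝ :=
  (Icc (0 : ℝ) 1).indicator fun x => (∫ t in (0 : ℝ)..x, u t) - x * ∫ t in (0 : ℝ)..1, u t

theorem meanFreePrimitive_of_mem {u : ℝ → ℝ} {x : ℝ} (hx : x ∈ Icc (0 : ℝ) 1) :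
    meanFreePrimitive u x = (∫ t in (0 : ℝ)..x, u t) - x * ∫ t in (0 : ℝ)..1, u t :=
  indicator_of_mem hx _

theorem isWeakDeriv_meanFreePrimitive {u : ℝ → ℝ}
    (hu : MemLp u 2 (volume.restrict (Icc (0 : ℝ) 1))) :
    IsWeakDeriv (meanFreePrimitive u) (fun t => u t - ∫ s in (0 : ℝ)..1, u s) := by
  refine ⟨hu.sub (memLp_const _), fun x hx => ?_⟩
  have h0 : (0 : ℝ) ∈ Icc (0 : ℝ) 1 := by simp
  rw [meanFreePrimitive_of_mem hx, meanFreePrimitive_of_mem h0, intervalIntegral.integral_sub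
    (intervalIntegrable_of_integrableOn_Icc (hu.integrable (by norm_num)) h0 hx) (by simp),
    intervalIntegral.integral_const]
  simp

theorem meanFreePrimitive_mem_H10 {u : ℝ → ℝ}
    (hu : MemLp u 2 (volume.restrict (Icc (0 : ℝ) 1))) : meanFreePrimitive u ∈ H10 := by
  refine ⟨fun x hx => ?_, _, isWeakDeriv_meanFreePrimitive hu⟩
  by_cases hx' : x ∈ Icc (0 : ℝ) 1
  · rw [meanFreePrimitive_of_mem hx']
    rcases eq_endpoints_or_mem_Ioo_of_mem_Icc hx' with rfl | rfl | h
    · simp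
    · simp
    · exact absurd h hx
  · exact indicator_of_notMem hx' _

theorem meanFreePrimitive_congr_ae {u v : ℝ → ℝ}
    (h : u =ᵐ[volume.restrict (Icc (0 : ℝ) 1)] v) : meanFreePrimitive u = meanFreePrimitive v :=
  indicator_congr fun x hx => by
    rw [integral_congr_ae_unit h hx, integral_congr_ae_unit h (by simp)]

/-- The linear map sending the class of `u` to the primitive of `u - ∫ u`. It is a left inverse
of `grad`. -/
def primitive : UnitL2 →ₗ[ℝ] H10 where
  toFun u := ⟨meanFreePrimitive u, meanFreePrimitive_mem_H10 (Lp.memLp u)⟩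
  map_add' u v := Subtype.ext <| by
    have hi (w : UnitL2) {x : ℝ} (hx : x ∈ Icc (0 : ℝ) 1) : IntervalIntegrable w volume 0 x :=
      intervalIntegrable_of_integrableOn_Icc ((Lp.memLp w).integrable (by norm_num)) (by simp) hx
    change meanFreePrimitive (u + v : UnitL2) = meanFreePrimitive u + meanFreePrimitive v
    rw [meanFreePrimitive_congr_ae (Lp.coeFn_add u v)]
    refine (indicator_congr fun x hx => ?_).trans (indicator_add' _ _ _)
    simp only [Pi.add_apply]
    rw [intervalIntegral.integral_add (hi u hx) (hi v hx),
      intervalIntegral.integral_add (hi u (by simp)) (hi v (by simp))]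
    ring
  map_smul' c u := Subtype.ext <| by
    change meanFreePrimitive (c • u : UnitL2) = c • meanFreePrimitive u
    rw [meanFreePrimitive_congr_ae (Lp.coeFn_smul c u)]
    refine (indicator_congr fun x _ => ?_).trans (indicator_const_smul _ c _)
    simp only [Pi.smul_apply, smul_eq_mul, intervalIntegral.integral_const_mul]
    ring

theorem grad_primitive_ae_eq (u : UnitL2) :
    grad (primitive u) =ᵐ[volume.restrict (Icc (0 : ℝ) 1)] fun t => u t - ∫ s in (0 : ℝ)..1, u s :=
  (isWeakDeriv_grad _).ae_unique (isWeakDeriv_meanFreePrimitive (Lp.memLp u))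

theorem inner_grad_primitive (u : UnitL2) (g : H10) :
    inner ℝ (grad (primitive u)) (grad g) = inner ℝ u (grad g) := by
  have hg := isWeakDeriv_grad g
  have hug : IntervalIntegrable (fun t => u t * grad g t) volume 0 1 :=
    intervalIntegrable_of_integrableOn_Icc ((Lp.memLp u).integrable_mul hg.1) (by simp) (by simp)
  have hsub : (fun t => grad (primitive u) t * grad g t) =ᵐ[volume.restrict (Icc (0 : ℝ) 1)]
      fun t => u t * grad g t - (∫ s in (0 : ℝ)..1, u s) * grad g t := by
    filter_upwards [grad_primitive_ae_eq u] with t ht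
    rw [ht, sub_mul]
  rw [UnitL2.inner_eq, UnitL2.inner_eq, integral_congr_ae_unit hsub (by simp),
    intervalIntegral.integral_sub hug ((hg.intervalIntegrable (by simp)).const_mul _),
    intervalIntegral.integral_const_mul, integral_grad, mul_zero, sub_zero]

theorem primitive_grad (f : H10) : primitive (grad f) = f := by
  refine grad_injective (Lp.ext ((grad_primitive_ae_eq _).trans ?_))
  simp [integral_grad]

theorem norm_grad_primitive_le (u : UnitL2) : ‖grad (primitive u)‖ ≤ ‖u‖ := by
  have h : ‖grad (primitive u)‖ ^ 2 ≤ ‖u‖ * ‖grad (primitive u)‖ := by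
    rw [← real_inner_self_eq_norm_sq, inner_grad_primitive]
    exact real_inner_le_norm _ _
  rcases (norm_nonneg (grad (primitive u))).eq_or_lt with h0 | h0
  · exact h0 ▸ norm_nonneg u
  · exact le_of_mul_le_mul_right (by rwa [← sq]) h0

end WeakDerivatives

section Embedding

variable (ν : Measure ℝ)

theorem aestronglyMeasurable_of_mem_H10 {f : ℝ → ℝ} (hf : f ∈ H10) : AEStronglyMeasurable f ν := by
  obtain ⟨hf0, u, hu⟩ := hf
  have hind : (Icc (0 : ℝ) 1).indicator f = f :=
    indicator_eq_self.2 fun x hx => by_contra fun hx' =>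
      hx (hf0 x fun h => hx' (Ioo_subset_Icc_self h))
  rw [← hind, aestronglyMeasurable_indicator_iff measurableSet_Icc]
  exact hu.continuousOn.aestronglyMeasurable measurableSet_Icc

variable [IsFiniteMeasure ν]

theorem memLp_two_of_mem_H10 (f : H10) : MemLp (f : ℝ → ℝ) 2 ν :=
  MemLp.of_bound (aestronglyMeasurable_of_mem_H10 ν f.2) ‖grad f‖
    (Eventually.of_forall (abs_apply_le_norm_grad f))

/-- The class in `L²(ν)` of an element of `H_0^1(0,1)`. -/
def toL2 : H10 →ₗ[ℝ] Lp ℝ 2 ν where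
  toFun f := (memLp_two_of_mem_H10 ν f).toLp
  map_add' f g := MemLp.toLp_add (memLp_two_of_mem_H10 ν f) (memLp_two_of_mem_H10 ν g)
  map_smul' c f := MemLp.toLp_const_smul c (memLp_two_of_mem_H10 ν f)

theorem toL2_ae_eq (f : H10) : toL2 ν f =ᵐ[ν] f := (memLp_two_of_mem_H10 ν f).coeFn_toLp

theorem inner_toL2 (f g : H10) : inner ℝ (toL2 ν f) (toL2 ν g) = innerNu ν f g := by
  rw [L2.inner_def, innerNu]
  refine integral_congr_ae ?_
  filter_upwards [toL2_ae_eq ν f, toL2_ae_eq ν g] with x hx hy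
  simp [hx, hy, mul_comm]

theorem norm_toL2_sq (f : H10) : ‖toL2 ν f‖ ^ 2 = innerNu ν f f := by
  rw [← inner_toL2, real_inner_self_eq_norm_sq]

theorem norm_toL2_le {f : H10} {C : ℝ} (h : ∀ x, |(f : ℝ → ℝ) x| ≤ C) :
    ‖toL2 ν f‖ ≤ measureUnivNNReal ν ^ (2 : ℝ≥0∞).toReal⁻¹ * C :=
  Lp.norm_le_of_ae_bound ((abs_nonneg _).trans (h 0)) <| by
    filter_upwards [toL2_ae_eq ν f] with x hx
    exact (congrArg norm hx).trans_le (h x)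

theorem abs_primitive_apply_le (u : UnitL2) (x : ℝ) : |(primitive u : ℝ → ℝ) x| ≤ ‖u‖ :=
  (abs_apply_le_norm_grad _ x).trans (norm_grad_primitive_le u)

/-- The embedding of `H_0^1(0,1)` into `L²(ν)`, transported to `L²([0,1])` along `primitive`. -/
def embed : UnitL2 →L[ℝ] Lp ℝ 2 ν :=
  (toL2 ν ∘ₗ primitive).mkContinuous (measureUnivNNReal ν ^ (2 : ℝ≥0∞).toReal⁻¹) fun u =>
    norm_toL2_le ν (abs_primitive_apply_le u)

theorem embed_apply (u : UnitL2) : embed ν u = toL2 ν (primitive u) := rfl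

theorem abs_apply_le_of_forall_apply_div_eq_zero {f : H10} {n : ℕ} (hn : 0 < n)
    (hf : ∀ k < n, (f : ℝ → ℝ) (k / n) = 0) (x : ℝ) : |(f : ℝ → ℝ) x| ≤ ‖grad f‖ / √n := by
  by_cases hx : x ∈ Ioo (0 : ℝ) 1
  · have hn0 : (0 : ℝ) < n := Nat.cast_pos.2 hn
    have hk : ⌊x * n⌋₊ < n := Nat.floor_lt' hn.ne' |>.2 (mul_lt_of_lt_one_left hn0 hx.2)
    have hkx : (⌊x * n⌋₊ : ℝ) / n ≤ x :=
      (div_le_iff₀ hn0).2 (Nat.floor_le (mul_nonneg hx.1.le hn0.le))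
    have hxk : x - ⌊x * n⌋₊ / n ≤ 1 / n := by
      rw [sub_le_iff_le_add, ← add_div, le_div_iff₀ hn0, add_comm]
      exact (Nat.lt_floor_add_one _).le
    refine abs_le_of_sq_le_sq ?_ (by positivity)
    calc (f : ℝ → ℝ) x ^ 2 = ((f : ℝ → ℝ) x - (f : ℝ → ℝ) (⌊x * n⌋₊ / n)) ^ 2 := by
          rw [hf _ hk, sub_zero]
      _ ≤ (x - ⌊x * n⌋₊ / n) * ‖grad f‖ ^ 2 :=
          sq_sub_le_mul_norm_grad_sq f (by positivity) hkx hx.2.le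
      _ ≤ 1 / n * ‖grad f‖ ^ 2 := by gcongr
      _ = (‖grad f‖ / √n) ^ 2 := by rw [div_pow, Real.sq_sqrt hn0.le]; ring
  · rw [f.2.1 x hx, abs_zero]
    positivity

/-- Evaluation of `primitive u` at a point. -/
def evalPrimitive (x : ℝ) : UnitL2 →L[ℝ] ℝ :=
  (LinearMap.proj x ∘ₗ H10.subtype ∘ₗ primitive).mkContinuous 1 fun u => by
    rw [one_mul]
    exact abs_primitive_apply_le u x

/-- A function vanishing at `0, 1/n, …, (n-1)/n` is uniformly small relative to its energy, so
`embed ν` is small on a subspace of finite codimension. -/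
theorem isCompactOperator_embed : IsCompactOperator (embed ν) := by
  refine isCompactOperator_of_forall_small_on_ker fun ε hε => ?_
  set M : ℝ := measureUnivNNReal ν ^ (2 : ℝ≥0∞).toReal⁻¹
  obtain ⟨n, hn⟩ := exists_nat_gt ((M / ε) ^ 2)
  have hn0 : (0 : ℝ) < n := (sq_nonneg _).trans_lt hn
  refine ⟨n, ContinuousLinearMap.pi fun k : Fin n => evalPrimitive (k / n), fun u hu => ?_⟩
  have hzero : ∀ k < n, (primitive u : ℝ → ℝ) (k / n) = 0 := fun k hk => congrFun hu ⟨k, hk⟩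
  have hM : M ≤ ε * √n := (div_le_iff₀' hε).1 (Real.le_sqrt_of_sq_le hn.le)
  calc ‖embed ν u‖ ≤ M * (‖grad (primitive u)‖ / √n) :=
        norm_toL2_le ν (abs_apply_le_of_forall_apply_div_eq_zero (Nat.cast_pos.1 hn0) hzero)
    _ ≤ ε * √n * (‖u‖ / √n) := by gcongr; exact norm_grad_primitive_le u
    _ = ε * ‖u‖ := by field_simp

end Embedding

section GreenOperator

variable (ν : Measure ℝ) [IsFiniteMeasure ν]

/-- The Green operator, transported to `L²([0,1])` along `grad`. Its nonzero eigenvalues are the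
inverses of the eigenvalues of the form. -/
def greenOp : UnitL2 →L[ℝ] UnitL2 :=
  ContinuousLinearMap.adjoint (embed ν) ∘L embed ν

theorem inner_greenOp (u v : UnitL2) :
    inner ℝ (greenOp ν u) v = innerNu ν (primitive u) (primitive v) := by
  rw [greenOp, ContinuousLinearMap.comp_apply, ContinuousLinearMap.adjoint_inner_left,
    embed_apply, embed_apply, inner_toL2]

theorem isSymmetric_greenOp : (greenOp ν : UnitL2 →ₗ[ℝ] UnitL2).IsSymmetric :=
  (ContinuousLinearMap.isPositive_adjoint_comp_self (embed ν)).isSymmetric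

theorem isCompactOperator_greenOp : IsCompactOperator (greenOp ν) :=
  (isCompactOperator_embed ν).clm_comp (ContinuousLinearMap.adjoint (embed ν))

variable {ν}

theorem energy_primitive_of_greenOp_eq_smul {u : UnitL2} {μ : ℝ} (hμ : μ ≠ 0)
    (hu : greenOp ν u = μ • u) (g : H10) :
    energy (primitive u) g = μ⁻¹ * innerNu ν (primitive u) g := by
  rw [← inner_grad, inner_grad_primitive, eq_inv_mul_iff_mul_eq₀ hμ, ← real_inner_smul_left, ← hu,
    inner_greenOp, primitive_grad]

theorem eq_zero_of_primitive_eq_zero {u : UnitL2} {μ : ℝ} (hμ : μ ≠ 0)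
    (hu : greenOp ν u = μ • u) (h : primitive u = 0) : u = 0 := by
  have hR : greenOp ν u = 0 := by
    rw [greenOp, ContinuousLinearMap.comp_apply, embed_apply, h, map_zero, map_zero]
  exact (smul_eq_zero.1 (hu.symm.trans hR)).resolve_left hμ

end GreenOperator

section AffineOnGaps

theorem IsWeakDeriv.comp_clamp {f u : ℝ → ℝ} (h : IsWeakDeriv f u) {a b : ℝ} (ha : 0 ≤ a)
    (hab : a ≤ b) (hb : b ≤ 1) :
    IsWeakDeriv (fun x => f (max a (min b x))) ((Ioc a b).indicator u) := by
  refine ⟨h.1.indicator measurableSet_Ioc, fun x hx => ?_⟩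
  have ha' : a ∈ Icc (0 : ℝ) 1 := ⟨ha, hab.trans hb⟩
  have hx' : max a (min b x) ∈ Icc (0 : ℝ) 1 :=
    ⟨ha.trans (le_max_left _ _), max_le ha'.2 ((min_le_right _ _).trans hx.2)⟩
  have hIoc : Ioc a (max a (min b x)) = Ioc 0 x ∩ Ioc a b := by
    ext t
    simp only [mem_Ioc, le_max_iff, le_min_iff, mem_inter_iff]
    grind
  have hint : ∫ t in (0 : ℝ)..x, (Ioc a b).indicator u t = ∫ t in a..max a (min b x), u t := by
    rw [intervalIntegral.integral_of_le hx.1, intervalIntegral.integral_of_le (le_max_left _ _),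
      setIntegral_indicator measurableSet_Ioc, hIoc]
  simp only [hint, ← h.sub_eq_integral ha' hx', min_eq_right (ha.trans hab), max_eq_left ha]
  ring

theorem IsWeakDeriv.sub_affine {f u : ℝ → ℝ} (h : IsWeakDeriv f u) (c s a : ℝ) :
    IsWeakDeriv (fun x => f x - c - s * (x - a)) fun t => u t - s := by
  refine ⟨h.1.sub (memLp_const s), fun x hx => ?_⟩
  simp only [intervalIntegral.integral_sub (h.intervalIntegrable hx) intervalIntegrable_const,
    h.2 x hx, intervalIntegral.integral_const, smul_eq_mul]
  ring

/-- The deviation of `f` from its chord over `[a, b]`, extended by zero. -/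
def chordDefect (f : ℝ → ℝ) (a b x : ℝ) : ℝ :=
  f (max a (min b x)) - f a - slope f a b * (max a (min b x) - a)

theorem chordDefect_of_mem {f : ℝ → ℝ} {a b x : ℝ} (hx : x ∈ Icc a b) :
    chordDefect f a b x = f x - f a - slope f a b * (x - a) := by
  rw [chordDefect, min_eq_right hx.2, max_eq_right hx.1]

theorem chordDefect_of_notMem_Ioo {f : ℝ → ℝ} {a b x : ℝ} (hab : a ≤ b) (hx : x ∉ Ioo a b) :
    chordDefect f a b x = 0 := by
  rw [mem_Ioo, not_and_or, not_lt, not_lt] at hx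
  rcases hx with hx | hx
  · simp [chordDefect, min_eq_right (hx.trans hab), max_eq_left hx]
  · rw [chordDefect, min_eq_left hx, max_eq_right hab, mul_comm, ← smul_eq_mul,
      sub_smul_slope, vsub_eq_sub, sub_self]

theorem isWeakDeriv_chordDefect {f u : ℝ → ℝ} (h : IsWeakDeriv f u) {a b : ℝ} (ha : 0 ≤ a)
    (hab : a ≤ b) (hb : b ≤ 1) :
    IsWeakDeriv (chordDefect f a b) ((Ioc a b).indicator fun t => u t - slope f a b) :=
  (h.sub_affine (f a) (slope f a b) a).comp_clamp ha hab hb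

theorem chordDefect_mem_H10 {f u : ℝ → ℝ} (h : IsWeakDeriv f u) {a b : ℝ} (ha : 0 ≤ a)
    (hab : a ≤ b) (hb : b ≤ 1) : chordDefect f a b ∈ H10 :=
  ⟨fun _ hx => chordDefect_of_notMem_Ioo hab fun hx' => hx (Ioo_subset_Ioo ha hb hx'),
    _, isWeakDeriv_chordDefect h ha hab hb⟩

theorem energy_chordDefect {f u : ℝ → ℝ} (h : IsWeakDeriv f u) {a b : ℝ} (ha : 0 ≤ a)
    (hab : a ≤ b) (hb : b ≤ 1) :
    energy f (chordDefect f a b) = energy (chordDefect f a b) (chordDefect f a b) := by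
  have hd := isWeakDeriv_chordDefect h ha hab hb
  set v := (Ioc a b).indicator fun t => u t - slope f a b with hv
  have huv : ∀ t, u t * v t = v t * v t + slope f a b * v t := fun t => by
    by_cases ht : t ∈ Ioc a b <;> simp only [hv, ht, indicator_of_mem, not_false_eq_true,
      indicator_of_notMem] <;> ring
  rw [energy_eq h hd, energy_eq hd hd, funext huv,
    intervalIntegral.integral_add (hd.mul_intervalIntegrable hd)
      ((hd.intervalIntegrable (by simp)).const_mul _),
    intervalIntegral.integral_const_mul,
    hd.integral_eq_zero_of_mem_H10 (chordDefect_mem_H10 h ha hab hb), mul_zero, add_zero]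

variable {ν : Measure ℝ} {f : ℝ → ℝ}

theorem innerNu_chordDefect_eq_zero {a b : ℝ} (hab : a ≤ b)
    (hν : ν (Icc a b) = 0) : innerNu ν f (chordDefect f a b) = 0 := by
  refine integral_eq_zero_of_ae ?_
  filter_upwards [measure_eq_zero_iff_ae_notMem.1 hν] with t ht
  rw [chordDefect_of_notMem_Ioo hab fun h => ht (Ioo_subset_Icc_self h), mul_zero, Pi.zero_apply]

theorem eq_zero_of_energy_self_eq_zero (hf : f ∈ H10) (h : energy f f = 0) : f = 0 := by
  have h0 : grad ⟨f, hf⟩ = 0 := norm_eq_zero.1 (sq_eq_zero_iff.1 ((norm_grad_sq _).trans h))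
  exact congrArg Subtype.val (grad_injective (h0.trans (map_zero grad).symm))

variable {lam : ℝ}

/-- Testing the eigenvalue equation with the chord defect shows that the defect vanishes. -/
theorem eq_add_slope_mul_of_measure_Icc_eq_zero (hf : f ∈ H10)
    (heq : ∀ g ∈ H10, energy f g = lam * innerNu ν f g) {a b : ℝ} (ha : 0 ≤ a) (hb : b ≤ 1)
    (hν : ν (Icc a b) = 0) {x : ℝ} (hx : x ∈ Icc a b) :
    f x = f a + slope f a b * (x - a) := by
  obtain ⟨-, u, hu⟩ := hf
  have hab : a ≤ b := hx.1.trans hx.2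
  have hmem := chordDefect_mem_H10 hu ha hab hb
  have hzero : chordDefect f a b = 0 := eq_zero_of_energy_self_eq_zero hmem <| by
    rw [← energy_chordDefect hu ha hab hb, heq _ hmem, innerNu_chordDefect_eq_zero hab hν,
      mul_zero]
  have := (chordDefect_of_mem hx).symm.trans (congrFun hzero x)
  rw [Pi.zero_apply] at this
  linarith

theorem eq_add_slope_mul_of_forall_three_points {s : Set ℝ}
    (h : ∀ a ∈ s, ∀ b ∈ s, ∀ x ∈ Icc a b, f x = f a + slope f a b * (x - a)) {a b : ℝ}
    (ha : a ∈ s) (hb : b ∈ s) (hab : a < b) {y : ℝ} (hy : y ∈ s) :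
    f y = f a + slope f a b * (y - a) := by
  have hba : b - a ≠ 0 := (sub_pos.2 hab).ne'
  rcases lt_or_ge y a with hya | hya
  · have := h y hy b hb a ⟨hya.le, hab.le⟩
    have h2 : b - y ≠ 0 := (sub_pos.2 (hya.trans hab)).ne'
    rw [slope_def_field] at this ⊢
    field_simp at this ⊢
    linarith
  · rcases le_or_gt y b with hyb | hyb
    · exact h a ha b hb y ⟨hya, hyb⟩
    · have := h a ha y hy b ⟨hab.le, hyb.le⟩
      have h2 : y - a ≠ 0 := (sub_pos.2 (hab.trans hyb)).ne'
      rw [slope_def_field] at this ⊢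
      field_simp at this ⊢
      linarith

theorem exists_affine_of_forall_three_points {s : Set ℝ}
    (h : ∀ a ∈ s, ∀ b ∈ s, ∀ x ∈ Icc a b, f x = f a + slope f a b * (x - a)) :
    ∃ c d : ℝ, ∀ y ∈ s, f y = c * y + d := by
  rcases s.subsingleton_or_nontrivial with hs | hs
  · rcases hs.eq_empty_or_singleton with rfl | ⟨x, rfl⟩
    · exact ⟨0, 0, by simp⟩
    · exact ⟨0, f x, by simp⟩
  · obtain ⟨a, ha, b, hb, hab⟩ := hs.exists_lt
    refine ⟨slope f a b, f a - slope f a b * a, fun y hy => ?_⟩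
    rw [eq_add_slope_mul_of_forall_three_points h ha hb hab hy]
    ring

theorem mem_CNu_of_forall_energy_eq (hf : f ∈ H10)
    (heq : ∀ g ∈ H10, energy f g = lam * innerNu ν f g) : f ∈ CNu ν := by
  obtain ⟨u, hu⟩ := hf.2
  refine ⟨hu.continuousOn, fun x _ => ?_⟩
  have hsub := connectedComponentIn_subset (Icc (0 : ℝ) 1 \ ν.support) x
  have hord : (connectedComponentIn (Icc (0 : ℝ) 1 \ ν.support) x).OrdConnected :=
    isPreconnected_connectedComponentIn.ordConnected
  refine exists_affine_of_forall_three_points fun a ha b hb y hy =>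
    eq_add_slope_mul_of_measure_Icc_eq_zero hf heq (hsub ha).1.1 (hsub hb).1.2 ?_ hy
  exact measure_mono_null (fun t ht => (hsub (hord.out ha hb ht)).2) Measure.measure_compl_support

end AffineOnGaps

section VariationalLowerBound

variable {ν : Measure ℝ} [IsFiniteMeasure ν]

theorem mem_eigenspace_of_forall_energy_eq {f : ℝ → ℝ} {lam : ℝ} (hf : f ∈ H10)
    (heq : ∀ g ∈ H10, energy f g = lam * innerNu ν f g) : f ∈ eigenspace ν lam :=
  ⟨⟨hf, mem_CNu_of_forall_energy_eq hf heq⟩, fun g hg => heq g hg.1⟩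

theorem finrank_eigenspace_greenOp_le {μ : ℝ} (hμ : μ ≠ 0) :
    (Module.finrank ℝ (Module.End.eigenspace (greenOp ν : UnitL2 →ₗ[ℝ] UnitL2) μ) : ℕ∞) ≤
      multiplicity ν μ⁻¹ := by
  let Φ : Module.End.eigenspace (greenOp ν : UnitL2 →ₗ[ℝ] UnitL2) μ →ₗ[ℝ] eigenspace ν μ⁻¹ :=
    (H10.subtype ∘ₗ primitive ∘ₗ Submodule.subtype _).codRestrict _ fun u =>
      mem_eigenspace_of_forall_energy_eq (primitive u.1).2 fun g hg =>
        energy_primitive_of_greenOp_eq_smul hμ (Module.End.mem_eigenspace_iff.1 u.2) ⟨g, hg⟩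
  have hΦ : Function.Injective Φ := (injective_iff_map_eq_zero Φ).2 fun u hu =>
    have hval : (Φ u : ℝ → ℝ) = 0 := congrArg Subtype.val hu
    Subtype.ext <| eq_zero_of_primitive_eq_zero hμ (Module.End.mem_eigenspace_iff.1 u.2) <|
      Subtype.ext hval
  calc _ ≤ Cardinal.toENat (Module.rank ℝ _) := ENat.natCast_toNat_le_self _
    _ ≤ multiplicity ν μ⁻¹ := Cardinal.toENat.monotone' (Φ.rank_le_of_injective hΦ)

theorem finrank_le_countingFunction {x : ℝ} (hx : 0 < x) {V : Type*} [AddCommGroup V] [Module ℝ V]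
    [FiniteDimensional ℝ V] (φ : V →ₗ[ℝ] H10)
    (hφ : ∀ c, c ≠ 0 → energy (φ c) (φ c) < x * innerNu ν (φ c) (φ c)) :
    (Module.finrank ℝ V : ℝ≥0∞) ≤ countingFunction ν x := by
  have hR : ∀ c, c ≠ 0 → x⁻¹ * ‖grad (φ c)‖ ^ 2 <
      inner ℝ (greenOp ν (grad (φ c))) (grad (φ c)) := fun c hc => by
    rw [inner_greenOp, primitive_grad, norm_grad_sq, inv_mul_lt_iff₀ hx]
    exact hφ c hc
  let inv : Ici x⁻¹ → Iic x := fun μ => ⟨(μ : ℝ)⁻¹, inv_le_of_inv_le₀ hx μ.2⟩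
  have hinv : Function.Injective inv := fun a b hab =>
    Subtype.ext (inv_injective (congrArg Subtype.val hab))
  refine (finrank_le_tsum_finrank_eigenspace (isCompactOperator_greenOp ν) (isSymmetric_greenOp ν)
    (inv_pos.2 hx) (grad ∘ₗ φ) hR).trans ?_
  refine le_trans (ENNReal.tsum_le_tsum fun μ => ?_)
    (ENNReal.tsum_comp_le_tsum_of_injective hinv fun lam => (multiplicity ν lam : ℝ≥0∞))
  exact_mod_cast ENat.toENNReal_le.2
    (finrank_eigenspace_greenOp_le (ν := ν) ((inv_pos.2 hx).trans_le μ.2).ne')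

end VariationalLowerBound

section VariationalUpperBound

variable {ν : Measure ℝ} [IsFiniteMeasure ν]

theorem eigenspace_le_H10 (lam : ℝ) : eigenspace ν lam ≤ H10 := fun _ hf => hf.1.1

theorem inner_grad_of_mem_eigenspace {lam : ℝ} {f g : H10} (hf : (f : ℝ → ℝ) ∈ eigenspace ν lam)
    (hg : (g : ℝ → ℝ) ∈ formDomain ν) :
    inner ℝ (grad f) (grad g) = lam * inner ℝ (toL2 ν f) (toL2 ν g) := by
  rw [inner_grad, inner_toL2, hf.2 g hg]

theorem inner_toL2_eq_zero_of_mem_eigenspace {a b : ℝ} (hab : a ≠ b) {f g : H10}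
    (hf : (f : ℝ → ℝ) ∈ eigenspace ν a) (hg : (g : ℝ → ℝ) ∈ eigenspace ν b) :
    inner ℝ (toL2 ν f) (toL2 ν g) = 0 := by
  have h := inner_grad_of_mem_eigenspace hg hf.1
  rw [real_inner_comm, inner_grad_of_mem_eigenspace hf hg.1,
    real_inner_comm (toL2 ν f) (toL2 ν g)] at h
  exact (mul_eq_mul_right_iff.1 h).resolve_left hab

variable {ι : Type*} [Fintype ι] {lam : ι → ℝ} {f : ι → H10}

theorem norm_toL2_sum_sq (hlam : Function.Injective lam)
    (hf : ∀ i, (f i : ℝ → ℝ) ∈ eigenspace ν (lam i)) :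
    ‖toL2 ν (∑ i, f i)‖ ^ 2 = ∑ i, ‖toL2 ν (f i)‖ ^ 2 := by
  rw [map_sum]
  exact norm_sq_sum_of_pairwise_inner_eq_zero fun i _ j _ hij =>
    inner_toL2_eq_zero_of_mem_eigenspace (hlam.ne hij) (hf i) (hf j)

theorem norm_grad_sum_sq (hlam : Function.Injective lam)
    (hf : ∀ i, (f i : ℝ → ℝ) ∈ eigenspace ν (lam i)) :
    ‖grad (∑ i, f i)‖ ^ 2 = ∑ i, ‖grad (f i)‖ ^ 2 := by
  rw [map_sum]
  refine norm_sq_sum_of_pairwise_inner_eq_zero fun i _ j _ hij =>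
    (inner_grad_of_mem_eigenspace (hf i) (hf j).1).trans ?_
  rw [inner_toL2_eq_zero_of_mem_eigenspace (hlam.ne hij) (hf i) (hf j), mul_zero]

theorem norm_grad_sum_sq_le {x : ℝ} (hlam : Function.Injective lam) (hx : ∀ i, lam i ≤ x)
    (hf : ∀ i, (f i : ℝ → ℝ) ∈ eigenspace ν (lam i)) :
    ‖grad (∑ i, f i)‖ ^ 2 ≤ x * ‖toL2 ν (∑ i, f i)‖ ^ 2 := by
  rw [norm_grad_sum_sq hlam hf, norm_toL2_sum_sq hlam hf, Finset.mul_sum]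
  refine Finset.sum_le_sum fun i _ => ?_
  rw [← real_inner_self_eq_norm_sq, ← real_inner_self_eq_norm_sq,
    inner_grad_of_mem_eigenspace (hf i) (hf i).1]
  exact mul_le_mul_of_nonneg_right (hx i) real_inner_self_nonneg

theorem eq_zero_of_norm_toL2_sum_sq_le {x c : ℝ} (hx0 : 0 ≤ x) (hxc : x * c < 1)
    (hlam : Function.Injective lam) (hx : ∀ i, lam i ≤ x)
    (hf : ∀ i, (f i : ℝ → ℝ) ∈ eigenspace ν (lam i))
    (hle : ‖toL2 ν (∑ i, f i)‖ ^ 2 ≤ c * ‖grad (∑ i, f i)‖ ^ 2) (i : ι) : f i = 0 := by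
  have hsq : ‖grad (∑ i, f i)‖ ^ 2 ≤ x * c * ‖grad (∑ i, f i)‖ ^ 2 :=
    (norm_grad_sum_sq_le hlam hx hf).trans <| by
      rw [mul_assoc]
      exact mul_le_mul_of_nonneg_left hle hx0
  have hzero : ∑ i, ‖grad (f i)‖ ^ 2 = 0 := by
    rw [← norm_grad_sum_sq hlam hf]
    nlinarith [sq_nonneg ‖grad (∑ i, f i)‖]
  have hi := (Finset.sum_eq_zero_iff_of_nonneg fun i _ => sq_nonneg _).1 hzero i (Finset.mem_univ i)
  exact grad_injective (by rw [map_zero, ← norm_eq_zero, ← sq_eq_zero_iff, hi])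

variable {W : Type*} [AddCommGroup W] [Module ℝ W] [FiniteDimensional ℝ W] {x c : ℝ}

theorem sum_multiplicity_le_finrank (hx0 : 0 ≤ x) (hxc : x * c < 1) (B : H10 →ₗ[ℝ] W)
    (hB : ∀ f : H10, B f = 0 → ‖toL2 ν f‖ ^ 2 ≤ c * ‖grad f‖ ^ 2)
    (hlam : Function.Injective lam) (hx : ∀ i, lam i ≤ x) :
    ∑ i, (multiplicity ν (lam i) : ℝ≥0∞) ≤ Module.finrank ℝ W := by
  classical
  let incl (i : ι) : eigenspace ν (lam i) →ₗ[ℝ] H10 := Submodule.inclusion (eigenspace_le_H10 _)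
  let Ψ : (∀ i, eigenspace ν (lam i)) →ₗ[ℝ] W := B ∘ₗ ∑ i, incl i ∘ₗ LinearMap.proj i
  have hΨ : Function.Injective Ψ := (injective_iff_map_eq_zero Ψ).2 fun F hF => funext fun i => by
    have hsum : Ψ F = B (∑ i, incl i (F i)) := by simp [Ψ]
    have h0 := eq_zero_of_norm_toL2_sum_sq_le hx0 hxc hlam hx (f := fun i => incl i (F i))
      (fun i => (F i).2) (hB _ (hsum.symm.trans hF)) i
    exact Submodule.inclusion_injective (eigenspace_le_H10 _) (h0.trans (map_zero (incl i)).symm)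
  have hfd (i : ι) : FiniteDimensional ℝ (eigenspace ν (lam i)) :=
    have := FiniteDimensional.of_injective Ψ hΨ
    FiniteDimensional.of_injective (LinearMap.single ℝ (fun i => eigenspace ν (lam i)) i)
      fun _ _ h => Pi.single_injective i h
  have hmult (i : ι) : multiplicity ν (lam i) = Module.finrank ℝ (eigenspace ν (lam i)) := by
    rw [multiplicity, ← Module.finrank_eq_rank, Cardinal.toENat_nat]
  have hle := LinearMap.finrank_le_finrank_of_injective hΨ
  rw [Module.finrank_pi_fintype] at hle
  simp only [hmult, ENat.toENNReal_coe]
  exact_mod_cast hle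

theorem countingFunction_le_finrank (hx0 : 0 ≤ x) (hxc : x * c < 1) (B : H10 →ₗ[ℝ] W)
    (hB : ∀ f : H10, B f = 0 → ‖toL2 ν f‖ ^ 2 ≤ c * ‖grad f‖ ^ 2) :
    countingFunction ν x ≤ Module.finrank ℝ W := by
  refine ENNReal.summable.tsum_le_of_sum_le fun S => ?_
  rw [← Finset.sum_coe_sort]
  exact sum_multiplicity_le_finrank hx0 hxc B hB (lam := fun i : S => ((i : Iic x) : ℝ))
    (Subtype.val_injective.comp Subtype.val_injective) fun i => i.1.2

theorem countingFunction_le_card (hx0 : 0 ≤ x) (hxc : x * c < 1) (P : Finset ℝ)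
    (hP : ∀ f ∈ H10, (∀ p ∈ P, f p = 0) → innerNu ν f f ≤ c * energy f f) :
    countingFunction ν x ≤ P.card := by
  refine (countingFunction_le_finrank hx0 hxc
    (LinearMap.funLeft ℝ ℝ ((↑) : P → ℝ) ∘ₗ H10.subtype) fun f hf => ?_).trans_eq ?_
  · rw [norm_toL2_sq, norm_grad_sq]
    exact hP f f.2 fun p hp => congrFun hf ⟨p, hp⟩
  · rw [Module.finrank_fintype_fun_eq_card, Fintype.card_coe]

end VariationalUpperBound

section Poincare

variable {ν : Measure ℝ} [IsFiniteMeasure ν] {f u : ℝ → ℝ}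

theorem setIntegral_sq_le_of_apply_left_eq_zero (hf : f ∈ H10) (hu : IsWeakDeriv f u) {a b : ℝ}
    (ha : 0 ≤ a) (hab : a ≤ b) (hb : b ≤ 1) (hfa : f a = 0) :
    ∫ t in Ioc a b, f t * f t ∂ν ≤ ν.real (Ioc a b) * (b - a) * ∫ t in Ioc a b, u t ^ 2 := by
  have hpt : ∀ t ∈ Ioc a b, f t * f t ≤ (b - a) * ∫ t in Ioc a b, u t ^ 2 := fun t ht => by
    have h := hu.sq_sub_le ha ht.1.le ht.2 hb
    rw [hfa, sub_zero, sq, intervalIntegral.integral_of_le hab] at h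
    exact h.trans (mul_le_mul_of_nonneg_right (sub_le_sub_right ht.2 a)
      (integral_nonneg fun t => sq_nonneg (u t)))
  refine (setIntegral_mono_on (integrable_mul ν hf hf).integrableOn integrableOn_const
    measurableSet_Ioc hpt).trans_eq ?_
  rw [setIntegral_const, smul_eq_mul, mul_assoc]

theorem sum_setIntegral_sq_le_energy (hu : IsWeakDeriv f u) {ι : Type*} {Q : Finset ι} {a b : ι → ℝ}
    (ha : ∀ i ∈ Q, 0 ≤ a i) (hb : ∀ i ∈ Q, b i ≤ 1)
    (hdisj : (Q : Set ι).Pairwise (Function.onFun Disjoint fun i => Ioc (a i) (b i))) :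
    ∑ i ∈ Q, ∫ t in Ioc (a i) (b i), u t ^ 2 ≤ energy f f := by
  have hsub : ⋃ i ∈ Q, Ioc (a i) (b i) ⊆ Icc 0 1 := iUnion₂_subset fun i hi t ht =>
    ⟨(ha i hi).trans ht.1.le, ht.2.trans (hb i hi)⟩
  rw [← integral_biUnion_finset Q (fun _ _ => measurableSet_Ioc) hdisj fun i hi =>
    hu.integrableOn_sq.mono_set ((subset_biUnion_of_mem (u := fun i => Ioc (a i) (b i)) hi).trans
      hsub), energy_self_eq hu, intervalIntegral.integral_of_le zero_le_one,
    ← integral_Icc_eq_integral_Ioc]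
  exact setIntegral_mono_set hu.integrableOn_sq (Eventually.of_forall fun t => sq_nonneg (u t))
    hsub.eventuallyLE

theorem innerNu_self_le_of_partition {ι : Type*} {Q : Finset ι} {a b : ι → ℝ} {c : ℝ}
    (ha : ∀ i ∈ Q, 0 ≤ a i) (hab : ∀ i ∈ Q, a i ≤ b i) (hb : ∀ i ∈ Q, b i ≤ 1)
    (hdisj : (Q : Set ι).Pairwise (Function.onFun Disjoint fun i => Ioc (a i) (b i)))
    (hcover : Ioo (0 : ℝ) 1 ⊆ ⋃ i ∈ Q, Ioc (a i) (b i)) (hc0 : 0 ≤ c)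
    (hc : ∀ i ∈ Q, ν.real (Ioc (a i) (b i)) * (b i - a i) ≤ c)
    (hf : f ∈ H10) (hfa : ∀ i ∈ Q, f (a i) = 0) : innerNu ν f f ≤ c * energy f f := by
  have hfint := integrable_mul ν hf hf
  obtain ⟨u, hu⟩ := hf.2
  have hsupp : innerNu ν f f = ∫ t in ⋃ i ∈ Q, Ioc (a i) (b i), f t * f t ∂ν := by
    rw [innerNu, setIntegral_eq_integral_of_forall_compl_eq_zero]
    intro x hx
    rw [hf.1 x fun h => hx (hcover h), mul_zero]
  calc innerNu ν f f = ∑ i ∈ Q, ∫ t in Ioc (a i) (b i), f t * f t ∂ν :=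
        hsupp.trans (integral_biUnion_finset Q (fun _ _ => measurableSet_Ioc) hdisj
          fun _ _ => hfint.integrableOn)
    _ ≤ ∑ i ∈ Q, c * ∫ t in Ioc (a i) (b i), u t ^ 2 := Finset.sum_le_sum fun i hi =>
        (setIntegral_sq_le_of_apply_left_eq_zero hf hu (ha i hi) (hab i hi) (hb i hi)
          (hfa i hi)).trans (mul_le_mul_of_nonneg_right (hc i hi)
            (integral_nonneg fun t => sq_nonneg (u t)))
    _ ≤ c * energy f f := by
        rw [← Finset.mul_sum]
        exact mul_le_mul_of_nonneg_left (sum_setIntegral_sq_le_energy hu ha hb hdisj) hc0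

end Poincare

section Dyadic

theorem mem_dyadic_iff {n k : ℕ} {x : ℝ} :
    x ∈ dyadic n k ↔ (k : ℝ) < x * 2 ^ n ∧ x * 2 ^ n ≤ k + 1 := by
  rw [dyadic, mem_Ioc, div_lt_iff₀ (by positivity), le_div_iff₀ (by positivity)]

theorem measurableSet_dyadic {n k : ℕ} : MeasurableSet (dyadic n k) := measurableSet_Ioc

theorem eq_of_mem_dyadic {n k k' : ℕ} {x : ℝ} (h : x ∈ dyadic n k) (h' : x ∈ dyadic n k') :
    k = k' := by
  rw [mem_dyadic_iff] at h h'
  have h1 : (k : ℝ) < k' + 1 := h.1.trans_le h'.2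
  have h2 : (k' : ℝ) < k + 1 := h'.1.trans_le h.2
  norm_cast at h1 h2
  omega

theorem pairwise_disjoint_dyadic (n : ℕ) : Pairwise (Function.onFun Disjoint (dyadic n)) :=
  fun _ _ hne => Set.disjoint_left.2 fun _ hx hx' => hne (eq_of_mem_dyadic hx hx')

theorem exists_mem_dyadic (n : ℕ) {x : ℝ} (hx : x ∈ Ioc (0 : ℝ) 1) :
    ∃ k < 2 ^ n, x ∈ dyadic n k := by
  have hxn : 0 < x * 2 ^ n := mul_pos hx.1 (by positivity)
  have hpos : 0 < ⌈x * 2 ^ n⌉₊ := Nat.ceil_pos.2 hxn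
  have hle : ⌈x * 2 ^ n⌉₊ ≤ 2 ^ n := by
    rw [Nat.ceil_le]
    push_cast
    exact mul_le_of_le_one_left (by positivity) hx.2
  refine ⟨⌈x * 2 ^ n⌉₊ - 1, by omega, mem_dyadic_iff.2 ?_⟩
  rw [Nat.cast_pred hpos, sub_add_cancel, sub_lt_iff_lt_add]
  exact ⟨Nat.ceil_lt_add_one hxn.le, Nat.le_ceil _⟩

theorem mem_dyadic_ancestor {m n k : ℕ} {x : ℝ} (hx : x ∈ dyadic n k) (hmn : m ≤ n) :
    x ∈ dyadic m (k / 2 ^ (n - m)) := by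
  obtain ⟨d, rfl⟩ := Nat.exists_eq_add_of_le hmn
  rw [mem_dyadic_iff, pow_add, ← mul_assoc] at hx
  rw [mem_dyadic_iff, Nat.add_sub_cancel_left]
  have hd : (0 : ℝ) < 2 ^ d := by positivity
  have hlower : ((k / 2 ^ d : ℕ) : ℝ) * 2 ^ d ≤ k := by exact_mod_cast Nat.div_mul_le_self k (2 ^ d)
  have hupper : (k : ℝ) + 1 ≤ (((k / 2 ^ d : ℕ) : ℝ) + 1) * 2 ^ d := by
    rw [mul_comm]
    exact_mod_cast Nat.lt_mul_div_succ k (pow_pos two_pos d)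
  exact ⟨lt_of_mul_lt_mul_right (hlower.trans_lt hx.1) hd.le,
    le_of_mul_le_mul_right (hx.2.trans hupper) hd⟩

theorem ancestor_lt {m n k : ℕ} (hk : k < 2 ^ n) (hmn : m ≤ n) : k / 2 ^ (n - m) < 2 ^ m :=
  Nat.div_lt_of_lt_mul (hk.trans_eq (by rw [← pow_add, Nat.sub_add_cancel hmn]))

end Dyadic

section StoppingIntervals

variable (ν : Measure ℝ)

/-- The sum defining the `L^q`-spectrum, as a real number. -/
def lqSum (n : ℕ) (q : ℝ) : ℝ :=
  ∑ k ∈ Finset.range (2 ^ n) with 0 < ν (dyadic n k), ν.real (dyadic n k) ^ q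

/-- The indices of the dyadic intervals of level `n` with mass at least `θ`. -/
def heavyIndices (θ : ℝ) (n : ℕ) : Finset ℕ :=
  {k ∈ Finset.range (2 ^ n) | θ ≤ ν.real (dyadic n k)}

/-- The indices of the dyadic intervals of level `n` at which the product of mass and length is
less than `t` for the first time; the ancestor of level `m` of `dyadic n k` has index
`k / 2 ^ (n - m)`. -/
def stoppingIndices (t : ℝ) (n : ℕ) : Finset ℕ :=
  {k ∈ Finset.range (2 ^ n) | ν.real (dyadic n k) < t * 2 ^ n ∧
    ∀ m < n, t * 2 ^ m ≤ ν.real (dyadic m (k / 2 ^ (n - m)))}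

variable {ν} {t : ℝ} {n : ℕ}

theorem mem_stoppingIndices {k : ℕ} : k ∈ stoppingIndices ν t n ↔ k < 2 ^ n ∧
    ν.real (dyadic n k) < t * 2 ^ n ∧ ∀ m < n, t * 2 ^ m ≤ ν.real (dyadic m (k / 2 ^ (n - m))) := by
  rw [stoppingIndices, Finset.mem_filter, Finset.mem_range]

theorem le_of_mem_stoppingIndices {n' k k' : ℕ} {y : ℝ} (hk : k ∈ stoppingIndices ν t n)
    (hk' : k' ∈ stoppingIndices ν t n') (hy : y ∈ dyadic n k) (hy' : y ∈ dyadic n' k') :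
    n' ≤ n := by
  by_contra! hlt
  have hanc := (mem_stoppingIndices.1 hk').2.2 n hlt
  rw [← eq_of_mem_dyadic hy (mem_dyadic_ancestor hy' hlt.le)] at hanc
  exact (mem_stoppingIndices.1 hk).2.1.not_ge hanc

theorem exists_mem_stoppingIndices [IsFiniteMeasure ν] {N : ℕ} (hN : ν.real univ < t * 2 ^ N)
    {y : ℝ} (hy : y ∈ Ioc (0 : ℝ) 1) :
    ∃ n ≤ N, ∃ k ∈ stoppingIndices ν t n, y ∈ dyadic n k := by
  classical
  let light (n : ℕ) : Prop := ∃ k < 2 ^ n, y ∈ dyadic n k ∧ ν.real (dyadic n k) < t * 2 ^ n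
  have hlight : light N := by
    obtain ⟨k, hk, hyk⟩ := exists_mem_dyadic N hy
    exact ⟨k, hk, hyk, (measureReal_mono (subset_univ _)).trans_lt hN⟩
  have hex : ∃ n, light n := ⟨N, hlight⟩
  obtain ⟨k, hk, hyk, hlt⟩ := Nat.find_spec hex
  refine ⟨Nat.find hex, Nat.find_min' hex hlight, k,
    mem_stoppingIndices.2 ⟨hk, hlt, fun m hm => ?_⟩, hyk⟩
  by_contra! hcon
  exact Nat.find_min hex hm ⟨_, ancestor_lt hk hm.le, mem_dyadic_ancestor hyk hm.le, hcon⟩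

theorem card_stoppingIndices_succ_le :
    (stoppingIndices ν t (n + 1)).card ≤ 2 * (heavyIndices ν (t * 2 ^ n) n).card := by
  refine Finset.card_le_mul_card_image_of_maps_to (f := (· / 2)) (fun k hk => ?_) _ fun j _ => ?_
  · obtain ⟨hk, -, hanc⟩ := mem_stoppingIndices.1 hk
    have hn := hanc n n.lt_succ_self
    rw [Nat.add_sub_cancel_left, pow_one] at hn
    exact Finset.mem_filter.2 ⟨Finset.mem_range.2 (Nat.div_lt_of_lt_mul (by rwa [← pow_succ'])), hn⟩
  · refine (Finset.card_le_card (t := {2 * j, 2 * j + 1}) fun k hk => ?_).trans Finset.card_le_two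
    have hkj : k / 2 = j := (Finset.mem_filter.1 hk).2
    simp only [Finset.mem_insert, Finset.mem_singleton]
    omega

theorem sum_card_stoppingIndices_le (N : ℕ) :
    ∑ n ∈ Finset.range (N + 1), (stoppingIndices ν t n).card ≤
      1 + 2 * ∑ n ∈ Finset.range N, (heavyIndices ν (t * 2 ^ n) n).card := by
  rw [Finset.sum_range_succ', add_comm, Finset.mul_sum]
  refine add_le_add ?_ (Finset.sum_le_sum fun n _ => card_stoppingIndices_succ_le)
  exact (Finset.card_filter_le _ _).trans_eq (by rw [pow_zero, Finset.card_range])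

theorem card_heavyIndices_le {θ q : ℝ} (hθ : 0 < θ) (hq : 0 ≤ q) :
    ((heavyIndices ν θ n).card : ℝ) ≤ θ ^ (-q) * lqSum ν n q := by
  have hsub : heavyIndices ν θ n ⊆ {k ∈ Finset.range (2 ^ n) | 0 < ν (dyadic n k)} :=
    Finset.monotone_filter_right _ fun k _ hk => (ENNReal.toReal_pos_iff.1 (hθ.trans_le hk)).1
  rw [Real.rpow_neg hθ.le, inv_mul_eq_div, le_div_iff₀ (Real.rpow_pos_of_pos hθ q), ← nsmul_eq_mul]
  calc (heavyIndices ν θ n).card • θ ^ q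
      ≤ ∑ k ∈ heavyIndices ν θ n, ν.real (dyadic n k) ^ q :=
        Finset.card_nsmul_le_sum _ _ _ fun k hk =>
          Real.rpow_le_rpow hθ.le (Finset.mem_filter.1 hk).2 hq
    _ ≤ lqSum ν n q := Finset.sum_le_sum_of_subset_of_nonneg hsub fun k _ _ =>
        Real.rpow_nonneg measureReal_nonneg q

/-- The stopping intervals partition `(0, 1]` into intervals on which the Poincaré constant is at
most `t`. -/
theorem countingFunction_le_sum_card_stoppingIndices [IsFiniteMeasure ν] {x : ℝ} (hx : 0 ≤ x)
    (ht : 0 ≤ t) (hxt : x * t < 1) {N : ℕ} (hN : ν.real univ < t * 2 ^ N) :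
    countingFunction ν x ≤ (∑ n ∈ Finset.range (N + 1), (stoppingIndices ν t n).card : ℕ) := by
  classical
  set Q := (Finset.range (N + 1)).sigma (stoppingIndices ν t) with hQ
  let a (p : Σ _ : ℕ, ℕ) : ℝ := p.2 / 2 ^ p.1
  let b (p : Σ _ : ℕ, ℕ) : ℝ := (p.2 + 1) / 2 ^ p.1
  have hmem {p : Σ _ : ℕ, ℕ} (hp : p ∈ Q) : p.2 ∈ stoppingIndices ν t p.1 :=
    (Finset.mem_sigma.1 hp).2
  have hlen (p) : b p - a p = 1 / 2 ^ p.1 := by simp only [a, b]; ring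
  have hb : ∀ p ∈ Q, b p ≤ 1 := fun p hp => by
    refine div_le_one_of_le₀ ?_ (by positivity)
    exact_mod_cast (mem_stoppingIndices.1 (hmem hp)).1
  have hdisj : (Q : Set (Σ _ : ℕ, ℕ)).Pairwise
      (Function.onFun Disjoint fun p => Ioc (a p) (b p)) := fun p hp p' hp' hne => by
    refine Set.disjoint_left.2 fun y (hy : y ∈ dyadic p.1 p.2) (hy' : y ∈ dyadic p'.1 p'.2) => ?_
    have hlevel : p.1 = p'.1 := (le_of_mem_stoppingIndices (hmem hp') (hmem hp) hy' hy).antisymm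
      (le_of_mem_stoppingIndices (hmem hp) (hmem hp') hy hy')
    exact hne (Sigma.ext hlevel (heq_of_eq (eq_of_mem_dyadic (hlevel ▸ hy) hy')))
  have hcover : Ioo (0 : ℝ) 1 ⊆ ⋃ p ∈ Q, Ioc (a p) (b p) := fun y hy => by
    obtain ⟨n, hn, k, hk, hyk⟩ := exists_mem_stoppingIndices hN (Ioo_subset_Ioc_self hy)
    exact mem_iUnion₂.2
      ⟨⟨n, k⟩, Finset.mem_sigma.2 ⟨Finset.mem_range.2 (Nat.lt_succ_of_le hn), hk⟩, hyk⟩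
  have hmass : ∀ p ∈ Q, ν.real (Ioc (a p) (b p)) * (b p - a p) ≤ t := fun p hp => by
    rw [hlen, mul_one_div, div_le_iff₀ (by positivity)]
    exact (mem_stoppingIndices.1 (hmem hp)).2.1.le
  refine (countingFunction_le_card hx hxt (Q.image a) fun f hf hfP => ?_).trans ?_
  · exact innerNu_self_le_of_partition (fun p _ => by positivity)
      (fun p _ => sub_nonneg.1 (by rw [hlen]; positivity)) hb hdisj hcover ht hmass hf
      fun p hp => hfP _ (Finset.mem_image_of_mem a hp)
  · rw [← Finset.card_sigma, ← hQ]
    exact_mod_cast Finset.card_image_le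

end StoppingIntervals

section UpperBound

variable {ν : Measure ℝ}

theorem lqSum_nonneg (n : ℕ) (q : ℝ) : 0 ≤ lqSum ν n q :=
  Finset.sum_nonneg fun _ _ => Real.rpow_nonneg measureReal_nonneg _

theorem sum_card_heavyIndices_le {q r C t : ℝ} (hq : 0 ≤ q) (hr : r < q)
    (h : ∀ n, lqSum ν n q ≤ C * 2 ^ (n * r)) (ht : 0 < t) (N : ℕ) :
    ∑ n ∈ Finset.range N, ((heavyIndices ν (t * 2 ^ n) n).card : ℝ) ≤
      t ^ (-q) * (C * (1 - 2 ^ (r - q))⁻¹) := by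
  have hC : 0 ≤ C := by simpa using (lqSum_nonneg 0 q).trans (h 0)
  have hρ0 : (0 : ℝ) ≤ 2 ^ (r - q) := by positivity
  have hρ1 : (2 : ℝ) ^ (r - q) < 1 := Real.rpow_lt_one_of_one_lt_of_neg one_lt_two (sub_neg.2 hr)
  have hterm (n : ℕ) : ((heavyIndices ν (t * 2 ^ n) n).card : ℝ) ≤
      t ^ (-q) * (C * (2 ^ (r - q)) ^ n) := by
    refine (card_heavyIndices_le (by positivity) hq).trans ?_
    rw [Real.mul_rpow ht.le (by positivity), mul_assoc]
    refine mul_le_mul_of_nonneg_left ((mul_le_mul_of_nonneg_left (h n) (by positivity)).trans_eq ?_)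
      (by positivity)
    rw [mul_left_comm, ← Real.rpow_natCast, ← Real.rpow_natCast, ← Real.rpow_mul two_pos.le,
      ← Real.rpow_mul two_pos.le, ← Real.rpow_add two_pos]
    ring_nf
  refine (Finset.sum_le_sum fun n _ => hterm n).trans ?_
  rw [← Finset.mul_sum, ← Finset.mul_sum, ← tsum_geometric_of_lt_one hρ0 hρ1]
  gcongr
  exact (summable_geometric_of_lt_one hρ0 hρ1).sum_le_tsum _ fun n _ => pow_nonneg hρ0 n

variable [IsFiniteMeasure ν]

theorem upperSpectralDim_le_of_eventually_le {s K : ℝ}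
    (h : ∀ᶠ x in atTop, countingFunction ν x ≤ ENNReal.ofReal (K * x ^ s)) :
    upperSpectralDim ν ≤ (s : EReal) := by
  refine EReal.le_of_forall_lt_iff_le.1 fun z hz => limsup_le_of_le (by isBoundedDefault) ?_
  have hsz : 0 < z - s := sub_pos.2 (EReal.coe_lt_coe_iff.1 hz)
  have hK : ∀ᶠ x : ℝ in atTop, K ≤ x ^ (z - s) :=
    (tendsto_rpow_atTop hsz).eventually_ge_atTop K
  filter_upwards [h, hK, eventually_gt_atTop 1] with x hx hxK hx1
  have hx0 : 0 < x := one_pos.trans hx1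
  have hxz : countingFunction ν x ≤ ENNReal.ofReal (x ^ z) := by
    refine hx.trans (ENNReal.ofReal_le_ofReal ?_)
    rw [← sub_add_cancel z s, Real.rpow_add hx0]
    gcongr
  rw [EReal.div_le_iff_le_mul (by exact_mod_cast Real.log_pos hx1) (EReal.coe_ne_top _)]
  refine (ENNReal.log_le_log hxz).trans_eq ?_
  rw [ENNReal.log_ofReal_of_pos (Real.rpow_pos_of_pos hx0 z), Real.log_rpow hx0, mul_comm]
  norm_cast

theorem upperSpectralDim_le_of_lqSum_le {q r C : ℝ} (hq : 0 ≤ q) (hr : r < q)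
    (h : ∀ n, lqSum ν n q ≤ C * 2 ^ (n * r)) : upperSpectralDim ν ≤ (q : EReal) := by
  set G : ℝ := C * (1 - 2 ^ (r - q))⁻¹
  refine upperSpectralDim_le_of_eventually_le (K := 1 + 2 * (2 ^ q * G)) ?_
  filter_upwards [eventually_ge_atTop 1] with x hx1
  have hx0 : 0 < x := one_pos.trans_le hx1
  have ht0 : 0 < (2 * x)⁻¹ := by positivity
  have hxt : x * (2 * x)⁻¹ < 1 := by field_simp; norm_num
  obtain ⟨N, hN⟩ : ∃ N : ℕ, ν.real univ < (2 * x)⁻¹ * 2 ^ N := by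
    obtain ⟨N, hN⟩ := pow_unbounded_of_one_lt (ν.real univ / (2 * x)⁻¹) one_lt_two
    exact ⟨N, (div_lt_iff₀' ht0).1 hN⟩
  refine (countingFunction_le_sum_card_stoppingIndices hx0.le ht0.le hxt hN).trans ?_
  rw [← ENNReal.ofReal_natCast]
  refine ENNReal.ofReal_le_ofReal ?_
  calc ((∑ n ∈ Finset.range (N + 1), (stoppingIndices ν (2 * x)⁻¹ n).card : ℕ) : ℝ)
      ≤ 1 + 2 * ∑ n ∈ Finset.range N, ((heavyIndices ν ((2 * x)⁻¹ * 2 ^ n) n).card : ℝ) := by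
        exact_mod_cast sum_card_stoppingIndices_le N
    _ ≤ 1 + 2 * ((2 * x)⁻¹ ^ (-q) * G) := by
        gcongr
        exact sum_card_heavyIndices_le hq hr h ht0 N
    _ = 1 + 2 * (2 ^ q * G) * x ^ q := by
        rw [Real.rpow_neg ht0.le, Real.inv_rpow (by positivity), inv_inv,
          Real.mul_rpow two_pos.le hx0.le]
        ring
    _ ≤ (1 + 2 * (2 ^ q * G)) * x ^ q := by
        rw [add_mul]
        gcongr
        rw [one_mul]
        exact Real.one_le_rpow hx1 hq

end UpperBound

section GrowthRates

open Asymptotics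

theorem sum_rpow_le_interpolate {ι : Type*} (s : Finset ι) {w : ι → ℝ} (hw : ∀ i ∈ s, 0 < w i)
    {a b t : ℝ} (ht : t ∈ Icc (0 : ℝ) 1) :
    ∑ i ∈ s, w i ^ ((1 - t) * a + t * b) ≤
      (∑ i ∈ s, w i ^ a) ^ (1 - t) * (∑ i ∈ s, w i ^ b) ^ t := by
  rcases ht.1.eq_or_lt with rfl | ht0
  · simp
  rcases ht.2.eq_or_lt with rfl | ht1
  · simp
  have h1t : 0 < 1 - t := sub_pos.2 ht1
  have hpow {p : ℝ} (hp : 0 < p) (c : ℝ) : ∑ i ∈ s, (w i ^ (p * c)) ^ p⁻¹ = ∑ i ∈ s, w i ^ c :=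
    Finset.sum_congr rfl fun i hi => by
      rw [← Real.rpow_mul (hw i hi).le, mul_right_comm, mul_inv_cancel₀ hp.ne', one_mul]
  have hpq : (1 - t)⁻¹.HolderConjugate t⁻¹ :=
    Real.holderConjugate_iff.2 ⟨(one_lt_inv₀ h1t).2 (by linarith), by simp only [inv_inv]; ring⟩
  have hholder := Real.inner_le_Lp_mul_Lq_of_nonneg s hpq
    (fun i hi => (Real.rpow_pos_of_pos (hw i hi) ((1 - t) * a)).le)
    (fun i hi => (Real.rpow_pos_of_pos (hw i hi) (t * b)).le)
  rw [hpow h1t, hpow ht0, one_div, one_div, inv_inv, inv_inv] at hholder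
  exact (Finset.sum_le_sum fun i hi => (Real.rpow_add (hw i hi) _ _).le).trans hholder

variable {ν : Measure ℝ}

theorem sum_measureReal_dyadic_le [IsFiniteMeasure ν] (n : ℕ) (s : Finset ℕ) :
    ∑ k ∈ s, ν.real (dyadic n k) ≤ ν.real univ := by
  rw [← measureReal_biUnion_finset (fun i _ j _ hij => pairwise_disjoint_dyadic n hij)
    fun k _ => measurableSet_dyadic]
  exact measureReal_mono (subset_univ _)

variable (ν) in
/-- The `L^q`-sums of `ν` grow at most like `2 ^ (n * r)`; the optimal `r` is `lqSpectrum ν q`. -/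
def HasLqRate (q r : ℝ) : Prop :=
  (fun n : ℕ => lqSum ν n q) =O[atTop] fun n : ℕ => (2 : ℝ) ^ (n * r)

theorem hasLqRate_zero_one : HasLqRate ν 0 1 := by
  refine IsBigO.of_norm_le fun n => ?_
  rw [Real.norm_of_nonneg (lqSum_nonneg n 0)]
  simp only [lqSum, Real.rpow_zero, Finset.sum_const, nsmul_eq_mul, mul_one, Real.rpow_natCast]
  exact_mod_cast (Finset.card_filter_le _ _).trans_eq (Finset.card_range _)

theorem hasLqRate_one_zero [IsFiniteMeasure ν] : HasLqRate ν 1 0 := by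
  refine IsBigO.of_bound (ν.real univ) (Eventually.of_forall fun n => ?_)
  rw [Real.norm_of_nonneg (lqSum_nonneg n 1)]
  simpa [lqSum] using sum_measureReal_dyadic_le n _

theorem HasLqRate.interpolate [IsFiniteMeasure ν] {a b ra rb t : ℝ} (ha : HasLqRate ν a ra)
    (hb : HasLqRate ν b rb) (ht : t ∈ Icc (0 : ℝ) 1) :
    HasLqRate ν ((1 - t) * a + t * b) ((1 - t) * ra + t * rb) := by
  have hpow (r p : ℝ) (n : ℕ) : ((2 : ℝ) ^ (n * r)) ^ p = 2 ^ (n * (p * r)) := by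
    rw [← Real.rpow_mul two_pos.le, mul_assoc, mul_comm r]
  have hsum (n : ℕ) : lqSum ν n ((1 - t) * a + t * b) ≤ lqSum ν n a ^ (1 - t) * lqSum ν n b ^ t :=
    sum_rpow_le_interpolate _
      (fun k hk => ENNReal.toReal_pos (Finset.mem_filter.1 hk).2.ne' (measure_ne_top _ _)) ht
  have hpos (r : ℝ) : 0 ≤ᶠ[atTop] fun n : ℕ => (2 : ℝ) ^ (n * r) :=
    Eventually.of_forall fun n => by positivity
  refine (IsBigO.of_norm_le fun n => ?_).trans
    (((ha.rpow (sub_nonneg.2 ht.2) (hpos ra)).mul (hb.rpow ht.1 (hpos rb))).congr_right fun n => ?_)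
  · exact (Real.norm_of_nonneg (lqSum_nonneg n _)).trans_le (hsum n)
  · rw [hpow, hpow, ← Real.rpow_add two_pos, ← mul_add]

theorem hasLqRate_of_mem_Icc [IsFiniteMeasure ν] {p : ℝ} (hp : p ∈ Icc (0 : ℝ) 1) :
    HasLqRate ν p (1 - p) := by
  simpa using hasLqRate_zero_one.interpolate hasLqRate_one_zero hp

theorem HasLqRate.exists_lt [IsFiniteMeasure ν] {p q r : ℝ} (h : HasLqRate ν p r)
    (hr : r < 1 - p) (hq : q ∈ Ioo (0 : ℝ) 1) : ∃ r' < 1 - q, HasLqRate ν q r' := by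
  rcases le_or_gt p q with hpq | hpq
  · have h1p : 0 < 1 - p := by linarith [hq.2]
    obtain ⟨t, ht0, ht1, htq⟩ : ∃ t, 0 ≤ t ∧ t < 1 ∧ (1 - t) * p + t * 1 = q :=
      ⟨(q - p) / (1 - p), div_nonneg (sub_nonneg.2 hpq) h1p.le,
        (div_lt_one h1p).2 (by linarith [hq.2]), by field_simp; ring⟩
    refine ⟨(1 - t) * r + t * 0, ?_, htq ▸ h.interpolate hasLqRate_one_zero ⟨ht0, ht1.le⟩⟩
    linarith [mul_lt_mul_of_pos_left hr (sub_pos.2 ht1)]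
  · have hp0 : 0 < p := hq.1.trans hpq
    obtain ⟨t, ht0, ht1, htq⟩ : ∃ t, 0 < t ∧ t < 1 ∧ (1 - t) * 0 + t * p = q :=
      ⟨q / p, div_pos hq.1 hp0, (div_lt_one hp0).2 hpq, by field_simp; ring⟩
    refine ⟨(1 - t) * 1 + t * r, ?_, htq ▸ hasLqRate_zero_one.interpolate h ⟨ht0.le, ht1.le⟩⟩
    linarith [mul_lt_mul_of_pos_left hr ht0]

theorem HasLqRate.upperSpectralDim_le [IsFiniteMeasure ν] {q r : ℝ} (h : HasLqRate ν q r)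
    (hq : 0 ≤ q) (hr : r < q) : upperSpectralDim ν ≤ (q : EReal) := by
  obtain ⟨C, -, hC⟩ := bound_of_isBigO_nat_atTop h
  refine upperSpectralDim_le_of_lqSum_le hq hr (C := C) fun n => ?_
  have hn := hC (x := n) (by positivity)
  rwa [Real.norm_of_nonneg (lqSum_nonneg n q), Real.norm_of_nonneg (by positivity)] at hn

theorem upperSpectralDim_le_half [IsFiniteMeasure ν] :
    upperSpectralDim ν ≤ ((1 / 2 : ℝ) : EReal) := by
  refine EReal.le_of_forall_lt_iff_le.1 fun z hz => ?_
  have hhalf : 1 / 2 < min z 1 := lt_min (EReal.coe_lt_coe_iff.1 hz) one_half_lt_one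
  have hrate : HasLqRate ν (min z 1) (1 - min z 1) :=
    hasLqRate_of_mem_Icc ⟨by linarith, min_le_right _ _⟩
  refine (hrate.upperSpectralDim_le (by linarith) (by linarith)).trans ?_
  exact_mod_cast min_le_left _ _

/-- A rate `r' < 1 / 2` at `q = 1 / 2` is interpolated with the trivial rate `1` at `q = 0`. -/
theorem HasLqRate.upperSpectralDim_lt_half [IsFiniteMeasure ν] {p r : ℝ} (h : HasLqRate ν p r)
    (hr : r < 1 - p) : upperSpectralDim ν < ((1 / 2 : ℝ) : EReal) := by
  obtain ⟨r', hr', hrate⟩ := h.exists_lt hr (q := 1 / 2) (by norm_num)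
  have hpos : 0 < 3 / 2 - r' := by linarith
  obtain ⟨t, ht, ht1⟩ := exists_between (inv_lt_one_of_one_lt₀ (by linarith : 1 < 3 / 2 - r'))
  have ht0 : 0 < t := (inv_pos.2 hpos).trans ht
  rw [inv_lt_iff_one_lt_mul₀ hpos] at ht
  have hdim := (hasLqRate_zero_one.interpolate hrate ⟨ht0.le, ht1.le⟩).upperSpectralDim_le
    (by linarith) (by linarith)
  refine hdim.trans_lt (EReal.coe_lt_coe_iff.2 (by linarith))

end GrowthRates

section LqSpectrum

open Asymptotics

theorem isLittleO_two_rpow_natCast_mul {r z : ℝ} (h : r < z) :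
    (fun n : ℕ => (2 : ℝ) ^ (n * r)) =o[atTop] fun n : ℕ => (2 : ℝ) ^ (n * z) := by
  have hrz : (2 : ℝ) ^ r < 2 ^ z := Real.rpow_lt_rpow_of_exponent_lt one_lt_two h
  simpa only [mul_comm, Real.rpow_mul_natCast two_pos.le] using
    isLittleO_pow_pow_of_lt_left (by positivity) hrz

variable {ν : Measure ℝ} {q r : ℝ}

theorem lqLevel_le_iff [IsFiniteMeasure ν] {n : ℕ} (hn : n ≠ 0) (hq : 0 ≤ q) :
    lqLevel ν n q ≤ (r : EReal) ↔ lqSum ν n q ≤ 2 ^ (n * r) := by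
  have hlog : 0 < Real.log (2 ^ n) := Real.log_pos (one_lt_pow₀ one_lt_two hn)
  have hpow : (0 : ℝ) < 2 ^ (n * r) := by positivity
  have hsum : ∑ k ∈ Finset.range (2 ^ n) with 0 < ν (dyadic n k), ν (dyadic n k) ^ q =
      ENNReal.ofReal (lqSum ν n q) := by
    rw [lqSum, ENNReal.ofReal_sum_of_nonneg fun k _ => Real.rpow_nonneg measureReal_nonneg _]
    refine Finset.sum_congr rfl fun k _ => ?_
    rw [← ENNReal.ofReal_rpow_of_nonneg measureReal_nonneg hq, ofReal_measureReal]
  have hmul : ((Real.log (2 ^ n) : ℝ) : EReal) * (r : EReal) =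
      ENNReal.log (ENNReal.ofReal (2 ^ (n * r))) := by
    rw [ENNReal.log_ofReal_of_pos hpow, Real.log_rpow two_pos, Real.log_pow, ← EReal.coe_mul,
      mul_right_comm]
  have hiff := ENNReal.ofReal_le_ofReal_iff (p := lqSum ν n q) hpow.le
  rw [← hsum] at hiff
  rw [lqLevel, EReal.div_le_iff_le_mul (by exact_mod_cast hlog) (EReal.coe_ne_top _), hmul,
    ENNReal.log_le_log_iff]
  convert hiff

variable [IsFiniteMeasure ν]

theorem hasLqRate_of_lqSpectrum_lt (hq : 0 ≤ q) (h : lqSpectrum ν q < (r : EReal)) :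
    HasLqRate ν q r := by
  refine IsBigO.of_bound' ?_
  filter_upwards [eventually_lt_of_limsup_lt h (by isBoundedDefault), eventually_ne_atTop 0]
    with n hn hn0
  rw [Real.norm_of_nonneg (lqSum_nonneg n q), Real.norm_of_nonneg (by positivity)]
  exact (lqLevel_le_iff hn0 hq).1 hn.le

theorem HasLqRate.lqSpectrum_le (h : HasLqRate ν q r) (hq : 0 ≤ q) :
    lqSpectrum ν q ≤ (r : EReal) := by
  refine EReal.le_of_forall_lt_iff_le.1 fun z hz => limsup_le_of_le (by isBoundedDefault) ?_
  have hlittle := isLittleO_two_rpow_natCast_mul (EReal.coe_lt_coe_iff.1 hz)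
  filter_upwards [(h.trans_isLittleO hlittle).def one_pos, eventually_ne_atTop 0] with n hn hn0
  rw [one_mul, Real.norm_of_nonneg (lqSum_nonneg n q), Real.norm_of_nonneg (by positivity)] at hn
  exact (lqLevel_le_iff hn0 hq).2 hn

theorem exists_hasLqRate_of_lqSpectrum_ne {p : ℝ} (hp : p ∈ Icc (0 : ℝ) 1)
    (h : lqSpectrum ν p ≠ ((1 - p : ℝ) : EReal)) : ∃ r < 1 - p, HasLqRate ν p r := by
  have hlt := ((hasLqRate_of_mem_Icc hp).lqSpectrum_le hp.1).lt_of_ne h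
  obtain ⟨r, hr, hr'⟩ := EReal.lt_iff_exists_real_btwn.1 hlt
  exact ⟨r, EReal.coe_lt_coe_iff.1 hr', hasLqRate_of_lqSpectrum_lt hp.1 hr⟩

theorem lqSpectrum_eq_of_upperSpectralDim_eq_half
    (h : upperSpectralDim ν = ((1 / 2 : ℝ) : EReal)) {p : ℝ} (hp : p ∈ Icc (0 : ℝ) 1) :
    lqSpectrum ν p = ((1 - p : ℝ) : EReal) := by
  by_contra hne
  obtain ⟨r, hr, hrate⟩ := exists_hasLqRate_of_lqSpectrum_ne hp hne
  exact (hrate.upperSpectralDim_lt_half hr).ne h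

theorem lqSpectrum_eq_of_lqSpectrum_eq (hq : q ∈ Ioo (0 : ℝ) 1)
    (h : lqSpectrum ν q = ((1 - q : ℝ) : EReal)) {p : ℝ} (hp : p ∈ Icc (0 : ℝ) 1) :
    lqSpectrum ν p = ((1 - p : ℝ) : EReal) := by
  by_contra hne
  obtain ⟨r, hr, hrate⟩ := exists_hasLqRate_of_lqSpectrum_ne hp hne
  obtain ⟨r', hr', hrate'⟩ := hrate.exists_lt hr hq
  have hle := hrate'.lqSpectrum_le hq.1.le
  rw [h, EReal.coe_le_coe_iff] at hle
  exact hle.not_gt hr'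

theorem eventually_rpow_le_lqSum_of_tendsto (hq : 0 ≤ q)
    (h : Tendsto (fun n : ℕ => lqLevel ν n q) atTop (𝓝 (r : EReal))) {r' : ℝ} (hr : r' < r) :
    ∀ᶠ n : ℕ in atTop, (2 : ℝ) ^ (n * r') ≤ lqSum ν n q := by
  filter_upwards [h.eventually_const_lt (EReal.coe_lt_coe_iff.2 hr), eventually_ne_atTop 0]
    with n hn hn0
  exact (lt_of_not_ge fun hle => hn.not_ge ((lqLevel_le_iff hn0 hq).2 hle)).le

end LqSpectrum

section TestFunctions

variable {ν : Measure ℝ} [IsFiniteMeasure ν]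

theorem mul_sum_sq_le_innerNu {ι : Type*} [Fintype ι] {f : ℝ → ℝ} (hf : f ∈ H10) {A : ι → Set ℝ}
    (hA : ∀ i, MeasurableSet (A i)) (hdisj : Pairwise (Function.onFun Disjoint A)) {c : ι → ℝ}
    (hfc : ∀ i, ∀ y ∈ A i, f y = c i) {θ : ℝ} (hmass : ∀ i, θ ≤ ν.real (A i)) :
    θ * ∑ i, c i ^ 2 ≤ innerNu ν f f := by
  have hint : Integrable (fun y => f y * f y) ν := integrable_mul ν hf hf
  calc θ * ∑ i, c i ^ 2
      ≤ ∑ i, ∫ y in A i, f y * f y ∂ν := by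
        rw [Finset.mul_sum]
        refine Finset.sum_le_sum fun i _ => ?_
        rw [setIntegral_congr_fun (hA i) fun y hy => by rw [hfc i y hy], setIntegral_const,
          smul_eq_mul, ← sq]
        exact mul_le_mul_of_nonneg_right (hmass i) (sq_nonneg _)
    _ = ∫ y in ⋃ i, A i, f y * f y ∂ν :=
        (integral_iUnion_fintype hA hdisj fun i => hint.integrableOn).symm
    _ ≤ innerNu ν f f :=
        setIntegral_le_integral hint (Eventually.of_forall fun y => mul_self_nonneg _)

/-- On the span of the functions `h i` the Rayleigh quotient is less than `x`. -/
theorem card_le_countingFunction_of_plateaus {ι : Type*} [Fintype ι] {h : ι → H10} {A : ι → Set ℝ}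
    {E θ x : ℝ} (hx : 0 < x) (horth : Pairwise fun i j => energy (h i) (h j) = 0)
    (hE : ∀ i, energy (h i) (h i) ≤ E) (hA : ∀ i, MeasurableSet (A i))
    (hone : ∀ i, ∀ y ∈ A i, (h i : ℝ → ℝ) y = 1)
    (hzero : ∀ i j, i ≠ j → ∀ y ∈ A i, (h j : ℝ → ℝ) y = 0)
    (hmass : ∀ i, θ ≤ ν.real (A i)) (hEx : E < x * θ) :
    (Fintype.card ι : ℝ≥0∞) ≤ countingFunction ν x := by
  have hdisj : Pairwise (Function.onFun Disjoint A) := fun i j hij =>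
    Set.disjoint_left.2 fun y hi hj =>
      one_ne_zero ((hone i y hi).symm.trans (hzero j i hij.symm y hj))
  let φ : (ι → ℝ) →ₗ[ℝ] H10 := Fintype.linearCombination ℝ h
  rw [← Module.finrank_fintype_fun_eq_card ℝ]
  refine finrank_le_countingFunction hx φ fun c hc => ?_
  set f := (φ c).1 with hf
  have hpos : 0 < ∑ i, c i ^ 2 := by
    obtain ⟨i, hi⟩ := Function.ne_iff.1 hc
    exact Finset.sum_pos' (fun j _ => sq_nonneg _) ⟨i, Finset.mem_univ i, sq_pos_of_ne_zero hi⟩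
  have hval : ∀ i, ∀ y ∈ A i, f y = c i := fun i y hy => by
    simp only [hf, φ, Fintype.linearCombination_apply, Submodule.coe_sum, Submodule.coe_smul,
      Finset.sum_apply, Pi.smul_apply, smul_eq_mul]
    rw [Finset.sum_eq_single_of_mem i (Finset.mem_univ i) fun j _ hji => by
      rw [hzero i j hji.symm y hy, mul_zero], hone i y hy, mul_one]
  have henergy : energy f f ≤ E * ∑ i, c i ^ 2 := by
    rw [hf, ← norm_grad_sq, Fintype.linearCombination_apply, map_sum,
      norm_sq_sum_of_pairwise_inner_eq_zero, Finset.mul_sum]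
    · refine Finset.sum_le_sum fun i _ => ?_
      rw [map_smul, norm_smul, mul_pow, norm_grad_sq, Real.norm_eq_abs, sq_abs, mul_comm]
      exact mul_le_mul_of_nonneg_right (hE i) (sq_nonneg _)
    · intro i _ j _ hij
      rw [map_smul, map_smul, inner_smul_left, inner_smul_right, inner_grad, horth hij, mul_zero,
        mul_zero]
  have hinner : θ * ∑ i, c i ^ 2 ≤ innerNu ν f f :=
    mul_sum_sq_le_innerNu (φ c).2 hA hdisj hval hmass
  calc energy f f ≤ E * ∑ i, c i ^ 2 := henergy
    _ < x * θ * ∑ i, c i ^ 2 := mul_lt_mul_of_pos_right hEx hpos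
    _ = x * (θ * ∑ i, c i ^ 2) := mul_assoc _ _ _
    _ ≤ x * innerNu ν f f := mul_le_mul_of_nonneg_left hinner hx.le

end TestFunctions

section DyadicHats

/-- The piecewise linear function that is `0` on `(-∞, 0]`, is `1` on `[1, ∞)` and rises in
between. -/
def ramp (y : ℝ) : ℝ := max 0 (min 1 y)

theorem ramp_of_nonpos {y : ℝ} (hy : y ≤ 0) : ramp y = 0 :=
  max_eq_left ((min_le_right _ _).trans hy)

theorem ramp_of_one_le {y : ℝ} (hy : 1 ≤ y) : ramp y = 1 := by
  rw [ramp, min_eq_left hy, max_eq_right zero_le_one]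

theorem isWeakDeriv_ramp {n k : ℕ} (hk : k < 2 ^ n) :
    IsWeakDeriv (fun x => ramp (x * 2 ^ n - k)) ((dyadic n k).indicator fun _ => 2 ^ n) := by
  have haffine : IsWeakDeriv (fun x => x * 2 ^ n - k) fun _ => 2 ^ n :=
    ⟨memLp_const _, fun x _ => by simp; ring⟩
  have hmono : Monotone fun x : ℝ => x * 2 ^ n - k := fun x y hxy => by dsimp only; gcongr
  have hle : ((k : ℝ) + 1) / 2 ^ n ≤ 1 :=
    div_le_one_of_le₀ (by exact_mod_cast hk) (by positivity)
  have hclamp : IsWeakDeriv _ ((dyadic n k).indicator fun _ => 2 ^ n) :=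
    haffine.comp_clamp (by positivity) (by gcongr; linarith) hle
  convert hclamp using 2 with x
  rw [hmono.map_max, hmono.map_min, ramp, div_mul_cancel₀ _ (by positivity),
    div_mul_cancel₀ _ (by positivity), sub_self, add_sub_cancel_left]

/-- The trapezoidal function that is `1` on `dyadic n (k + 1)` and vanishes outside this interval
and its two neighbours. -/
def dyadicHat (n k : ℕ) (x : ℝ) : ℝ := ramp (x * 2 ^ n - k) - ramp (x * 2 ^ n - (k + 2 : ℕ))

/-- The weak derivative of `dyadicHat n k`. -/
def dyadicHatDeriv (n k : ℕ) (t : ℝ) : ℝ :=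
  (dyadic n k).indicator (fun _ => 2 ^ n) t - (dyadic n (k + 2)).indicator (fun _ => 2 ^ n) t

variable {n k j : ℕ}

theorem isWeakDeriv_dyadicHat (hk : k + 3 ≤ 2 ^ n) :
    IsWeakDeriv (dyadicHat n k) (dyadicHatDeriv n k) := by
  have h := (isWeakDeriv_ramp (n := n) (k := k) (by omega)).add
    ((isWeakDeriv_ramp (n := n) (k := k + 2) (by omega)).smul (-1))
  convert h using 1 <;> ext x <;>
    simp only [dyadicHat, dyadicHatDeriv, Pi.add_apply, Pi.smul_apply, smul_eq_mul] <;> ring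

theorem dyadicHat_mem_H10 (hk : k + 3 ≤ 2 ^ n) : dyadicHat n k ∈ H10 := by
  refine ⟨fun x hx => ?_, _, isWeakDeriv_dyadicHat hk⟩
  have hk' : (k : ℝ) + 3 ≤ 2 ^ n := by exact_mod_cast hk
  have hn : (0 : ℝ) < 2 ^ n := by positivity
  have hk0 : (0 : ℝ) ≤ k := k.cast_nonneg
  rw [dyadicHat]
  push_cast
  rcases le_or_gt x 0 with hx0 | hx0
  · have hxn : x * 2 ^ n ≤ 0 := mul_nonpos_of_nonpos_of_nonneg hx0 hn.le
    rw [ramp_of_nonpos (by linarith [hk0]), ramp_of_nonpos (by linarith [hk0]), sub_self]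
  · have hxn : 2 ^ n ≤ x * 2 ^ n :=
      le_mul_of_one_le_left hn.le (not_lt.1 fun hx1 => hx ⟨hx0, hx1⟩)
    rw [ramp_of_one_le (by linarith), ramp_of_one_le (by linarith), sub_self]

theorem dyadicHat_of_mem {x : ℝ} (hx : x ∈ dyadic n (k + 1)) : dyadicHat n k x = 1 := by
  obtain ⟨h1, h2⟩ := mem_dyadic_iff.1 hx
  push_cast at h1 h2
  rw [dyadicHat, ramp_of_one_le (by linarith), ramp_of_nonpos (by push_cast; linarith), sub_zero]

theorem dyadicHat_of_mem_of_far {x : ℝ} (hx : x ∈ dyadic n (j + 1))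
    (hjk : j + 3 ≤ k ∨ k + 3 ≤ j) : dyadicHat n k x = 0 := by
  obtain ⟨h1, h2⟩ := mem_dyadic_iff.1 hx
  push_cast at h1 h2
  rcases hjk with hjk | hjk
  · have : (j : ℝ) + 3 ≤ k := by exact_mod_cast hjk
    rw [dyadicHat, ramp_of_nonpos (by linarith), ramp_of_nonpos (by push_cast; linarith), sub_self]
  · have : (k : ℝ) + 3 ≤ j := by exact_mod_cast hjk
    rw [dyadicHat, ramp_of_one_le (by linarith), ramp_of_one_le (by push_cast; linarith), sub_self]

theorem indicator_dyadic_mul_indicator_dyadic (h : k ≠ j) (c t : ℝ) :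
    (dyadic n k).indicator (fun _ => c) t * (dyadic n j).indicator (fun _ => c) t = 0 := by
  by_cases hk : t ∈ dyadic n k
  · rw [indicator_of_notMem fun hj => h (eq_of_mem_dyadic hk hj), mul_zero]
  · rw [indicator_of_notMem hk, zero_mul]

theorem energy_dyadicHat_of_far (hk : k + 3 ≤ 2 ^ n) (hj : j + 3 ≤ 2 ^ n)
    (hkj : k + 3 ≤ j ∨ j + 3 ≤ k) : energy (dyadicHat n k) (dyadicHat n j) = 0 := by
  rw [energy_eq (isWeakDeriv_dyadicHat hk) (isWeakDeriv_dyadicHat hj)]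
  refine (intervalIntegral.integral_congr fun t _ => ?_).trans intervalIntegral.integral_zero
  have hne {a b : ℕ} (hab : a ≠ b) :=
    indicator_dyadic_mul_indicator_dyadic (n := n) hab (2 ^ n) t
  simp only [dyadicHatDeriv]
  linear_combination hne (a := k) (b := j) (by omega) - hne (a := k) (b := j + 2) (by omega) -
    hne (a := k + 2) (b := j) (by omega) + hne (a := k + 2) (b := j + 2) (by omega)

theorem intervalIntegral_indicator_dyadic (hk : k < 2 ^ n) (c : ℝ) :
    ∫ t in (0 : ℝ)..1, (dyadic n k).indicator (fun _ => c) t = c / 2 ^ n := by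
  have hsub : dyadic n k ⊆ Ioc 0 1 := fun x hx => ⟨lt_of_le_of_lt (by positivity) hx.1,
    hx.2.trans (div_le_one_of_le₀ (by exact_mod_cast hk) (by positivity))⟩
  have hvol : volume.real (dyadic n k) = 1 / 2 ^ n := by
    rw [dyadic, Real.volume_real_Ioc_of_le (by gcongr; linarith)]
    ring
  rw [intervalIntegral.integral_of_le zero_le_one, setIntegral_indicator measurableSet_dyadic,
    inter_eq_self_of_subset_right hsub, setIntegral_const, hvol, smul_eq_mul, one_div_mul_eq_div]

theorem energy_dyadicHat_self (hk : k + 3 ≤ 2 ^ n) :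
    energy (dyadicHat n k) (dyadicHat n k) = 2 * 2 ^ n := by
  have hsq (t : ℝ) : dyadicHatDeriv n k t ^ 2 =
      (dyadic n k).indicator (fun _ => (2 ^ n) ^ 2) t +
        (dyadic n (k + 2)).indicator (fun _ => (2 ^ n) ^ 2) t := by
    have hmul := indicator_dyadic_mul_indicator_dyadic (n := n) (k := k) (j := k + 2) (by omega)
      (2 ^ n) t
    rw [dyadicHatDeriv, sub_sq, mul_assoc, hmul, mul_zero, sub_zero]
    simp only [indicator, ite_pow, zero_pow two_ne_zero]
  have hint (j : ℕ) : IntervalIntegrable ((dyadic n j).indicator fun _ => ((2 : ℝ) ^ n) ^ 2)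
      volume 0 1 := by
    rw [intervalIntegrable_iff_integrableOn_Ioc_of_le zero_le_one]
    exact (integrable_const _).indicator measurableSet_dyadic
  rw [energy_self_eq (isWeakDeriv_dyadicHat hk)]
  simp only [hsq]
  rw [intervalIntegral.integral_add (hint k) (hint (k + 2)),
    intervalIntegral_indicator_dyadic (by omega), intervalIntegral_indicator_dyadic (by omega)]
  field_simp
  ring

end DyadicHats

section LowerBound

variable {ν : Measure ℝ} [IsFiniteMeasure ν] {n : ℕ} {θ x : ℝ}

theorem card_le_countingFunction_of_separated {B : Finset ℕ} (hx : 0 < x)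
    (hB : ∀ k ∈ B, k + 3 ≤ 2 ^ n)
    (hsep : (B : Set ℕ).Pairwise fun k j => k + 3 ≤ j ∨ j + 3 ≤ k)
    (hmass : ∀ k ∈ B, θ ≤ ν.real (dyadic n (k + 1))) (hxθ : 2 * 2 ^ n < x * θ) :
    (B.card : ℝ≥0∞) ≤ countingFunction ν x := by
  have hfar {k j : B} (hkj : k ≠ j) := hsep k.2 j.2 (Subtype.coe_ne_coe.2 hkj)
  rw [← Fintype.card_coe]
  exact card_le_countingFunction_of_plateaus (ι := B) hx
    (h := fun k => ⟨dyadicHat n k, dyadicHat_mem_H10 (hB k k.2)⟩) (A := fun k => dyadic n (k + 1))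
    (fun k j hkj => energy_dyadicHat_of_far (hB k k.2) (hB j j.2) (hfar hkj))
    (fun k => (energy_dyadicHat_self (hB k k.2)).le) (fun _ => measurableSet_dyadic)
    (fun _ _ => dyadicHat_of_mem) (fun _ _ hkj _ hy => dyadicHat_of_mem_of_far hy (hfar hkj))
    (fun k => hmass k k.2) hxθ

/-- The two boundary intervals carry no hat; the remaining ones are split according to their index
modulo `3`. -/
theorem card_heavyIndices_le_countingFunction (hx : 0 < x) (hxθ : 2 * 2 ^ n < x * θ) :
    ((heavyIndices ν θ n).card : ℝ≥0∞) ≤ 2 + 3 * countingFunction ν x := by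
  classical
  set B := {k ∈ Finset.range (2 ^ n - 2) | k + 1 ∈ heavyIndices ν θ n} with hB
  have hmem {k : ℕ} (hk : k ∈ B) : k + 3 ≤ 2 ^ n ∧ k + 1 ∈ heavyIndices ν θ n := by
    rw [hB, Finset.mem_filter, Finset.mem_range] at hk
    exact ⟨by omega, hk.2⟩
  have hresidue (r : ℕ) : (({k ∈ B | k % 3 = r}).card : ℝ≥0∞) ≤ countingFunction ν x := by
    refine card_le_countingFunction_of_separated hx
      (fun k hk => (hmem (Finset.mem_filter.1 hk).1).1) (fun k hk j hj hkj => ?_)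
      (fun k hk => (Finset.mem_filter.1 (hmem (Finset.mem_filter.1 hk).1).2).2) hxθ
    have hkr := (Finset.mem_filter.1 hk).2
    have hjr := (Finset.mem_filter.1 hj).2
    omega
  have hsub : heavyIndices ν θ n ⊆ {0, 2 ^ n - 1} ∪ B.image (· + 1) := fun k hk => by
    have hlt : k < 2 ^ n := Finset.mem_range.1 (Finset.mem_filter.1 hk).1
    rcases k with _ | k
    · simp
    · simp only [hB, Finset.mem_union, Finset.mem_insert, Finset.mem_singleton, Finset.mem_image,
        Finset.mem_filter, Finset.mem_range]
      by_cases hlast : k + 1 = 2 ^ n - 1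
      · exact Or.inl (Or.inr hlast)
      · exact Or.inr ⟨k, ⟨by omega, hk⟩, rfl⟩
  have hcard : (heavyIndices ν θ n).card ≤
      2 + ∑ r ∈ Finset.range 3, ({k ∈ B | k % 3 = r}).card := by
    rw [← Finset.card_eq_sum_card_fiberwise fun k _ =>
      Finset.mem_coe.2 (Finset.mem_range.2 (k.mod_lt three_pos))]
    exact (Finset.card_le_card hsub).trans <| (Finset.card_union_le _ _).trans <|
      add_le_add Finset.card_le_two Finset.card_image_le
  calc ((heavyIndices ν θ n).card : ℝ≥0∞)
      ≤ 2 + ∑ r ∈ Finset.range 3, (({k ∈ B | k % 3 = r}).card : ℝ≥0∞) := by exact_mod_cast hcard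
    _ ≤ 2 + ∑ _r ∈ Finset.range 3, countingFunction ν x := by
        gcongr with r
        exact hresidue r
    _ = 2 + 3 * countingFunction ν x := by simp

end LowerBound

section HeavyIntervals

variable {ν : Measure ℝ} [IsFiniteMeasure ν] {q : ℝ}

/-- Light intervals are counted, heavy intervals are estimated by Hölder's inequality. -/
theorem lqSum_le_add_card_heavyIndices (hq : q ∈ Icc (0 : ℝ) 1) {θ : ℝ} (hθ : 0 < θ) (n : ℕ) :
    lqSum ν n q ≤
      2 ^ n * θ ^ q + ((heavyIndices ν θ n).card : ℝ) ^ (1 - q) * ν.real univ ^ q := by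
  have hsplit : lqSum ν n q ≤
      ∑ _k ∈ Finset.range (2 ^ n), θ ^ q + ∑ k ∈ heavyIndices ν θ n, ν.real (dyadic n k) ^ q := by
    rw [lqSum, heavyIndices, Finset.sum_filter, Finset.sum_filter, ← Finset.sum_add_distrib]
    refine Finset.sum_le_sum fun k _ => ?_
    have hmass : 0 ≤ ν.real (dyadic n k) ^ q := Real.rpow_nonneg measureReal_nonneg _
    have hθq : 0 ≤ θ ^ q := Real.rpow_nonneg hθ.le _
    split_ifs with _ hk hk
    · linarith
    · linarith [Real.rpow_le_rpow measureReal_nonneg (not_le.1 hk).le hq.1]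
    · linarith
    · linarith
  have hheavy := sum_rpow_le_interpolate (heavyIndices ν θ n) (w := fun k => ν.real (dyadic n k))
    (a := 0) (b := 1) (fun k hk => hθ.trans_le (Finset.mem_filter.1 hk).2) hq
  simp only [mul_zero, mul_one, zero_add, Real.rpow_zero, Real.rpow_one, Finset.sum_const,
    nsmul_eq_mul] at hheavy
  refine hsplit.trans (add_le_add (by simp) (hheavy.trans ?_))
  gcongr
  · exact hq.1
  · exact sum_measureReal_dyadic_le n _

theorem eventually_rpow_le_card_heavyIndices (hq : q ∈ Ioo (0 : ℝ) 1)
    (h : ∀ r < 1 - q, ∀ᶠ n : ℕ in atTop, (2 : ℝ) ^ (n * r) ≤ lqSum ν n q) {η : ℝ} (hη : 0 < η) :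
    ∀ᶠ n : ℕ in atTop,
      (2 : ℝ) ^ (n * (1 - η)) ≤ (heavyIndices ν (2 ^ (-(n * (1 + η)))) n).card := by
  have h1q : 0 < 1 - q := sub_pos.2 hq.2
  obtain ⟨r, hr, hr'⟩ := exists_between (max_lt (by nlinarith [hq.1] : 1 - q * (1 + η) < 1 - q)
    (by nlinarith : (1 - q) * (1 - η) < 1 - q))
  have hlittle := (isLittleO_two_rpow_natCast_mul ((le_max_left _ _).trans_lt hr)).add
    ((isLittleO_two_rpow_natCast_mul ((le_max_right _ _).trans_lt hr)).const_mul_left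
      (ν.real univ ^ q))
  filter_upwards [h r hr', hlittle.def one_half_pos] with n hn hsmall
  by_contra! hcard
  have hX : (0 : ℝ) < 2 ^ (n * r) := by positivity
  have hupper := lqSum_le_add_card_heavyIndices (ν := ν) (Ioo_subset_Icc_self hq)
    (by positivity : (0 : ℝ) < 2 ^ (-(n * (1 + η)))) n
  have hlight : (2 : ℝ) ^ n * (2 ^ (-(n * (1 + η)))) ^ q = 2 ^ (n * (1 - q * (1 + η))) := by
    rw [← Real.rpow_natCast, ← Real.rpow_mul two_pos.le, ← Real.rpow_add two_pos]
    ring_nf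
  have hheavy : ((heavyIndices ν (2 ^ (-(n * (1 + η)))) n).card : ℝ) ^ (1 - q) ≤
      2 ^ (n * ((1 - q) * (1 - η))) := by
    refine (Real.rpow_le_rpow (Nat.cast_nonneg _) hcard.le h1q.le).trans_eq ?_
    rw [← Real.rpow_mul two_pos.le]
    ring_nf
  rw [Real.norm_of_nonneg hX.le] at hsmall
  have hM := mul_le_mul_of_nonneg_right hheavy (by positivity : 0 ≤ ν.real univ ^ q)
  rw [hlight] at hupper
  linarith [le_of_abs_le hsmall]

end HeavyIntervals

section LowerSpectralDim

variable {ν : Measure ℝ} [IsFiniteMeasure ν]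

theorem le_lowerSpectralDim_of_eventually_le {s K : ℝ} (hK : 0 < K)
    (h : ∀ᶠ x in atTop, ENNReal.ofReal (K * x ^ s) ≤ countingFunction ν x) :
    (s : EReal) ≤ lowerSpectralDim ν := by
  refine EReal.ge_of_forall_gt_iff_ge.1 fun z hz => le_liminf_of_le (by isBoundedDefault) ?_
  have hzs : 0 < s - z := sub_pos.2 (EReal.coe_lt_coe_iff.1 hz)
  have hlarge : ∀ᶠ x : ℝ in atTop, K⁻¹ ≤ x ^ (s - z) :=
    (tendsto_rpow_atTop hzs).eventually_ge_atTop K⁻¹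
  filter_upwards [h, hlarge, eventually_gt_atTop 1] with x hx hxK hx1
  have hx0 : 0 < x := one_pos.trans hx1
  have hxz : ENNReal.ofReal (x ^ z) ≤ countingFunction ν x := by
    refine (ENNReal.ofReal_le_ofReal ?_).trans hx
    rw [← sub_add_cancel s z, Real.rpow_add hx0, ← mul_assoc]
    exact le_mul_of_one_le_left (by positivity) ((inv_le_iff_one_le_mul₀' hK).1 hxK)
  rw [EReal.le_div_iff_mul_le (by exact_mod_cast Real.log_pos hx1) (EReal.coe_ne_top _)]
  refine le_trans (le_of_eq ?_) (ENNReal.log_le_log hxz)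
  rw [ENNReal.log_ofReal_of_pos (Real.rpow_pos_of_pos hx0 z), Real.log_rpow hx0]
  norm_cast

theorem le_lowerSpectralDim_of_eventually_le_add_mul {s K : ℝ} (hs : 0 < s) (hK : 0 < K)
    (h : ∀ᶠ x in atTop, ENNReal.ofReal (K * x ^ s) ≤ 2 + 3 * countingFunction ν x) :
    (s : EReal) ≤ lowerSpectralDim ν := by
  refine le_lowerSpectralDim_of_eventually_le (K := K / 6) (by positivity) ?_
  have hlarge : ∀ᶠ x : ℝ in atTop, 4 ≤ K * x ^ s :=
    ((tendsto_rpow_atTop hs).const_mul_atTop hK).eventually_ge_atTop 4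
  filter_upwards [h, hlarge] with x hx hx4
  by_contra! hlt
  refine hx.not_gt ?_
  calc 2 + 3 * countingFunction ν x < 2 + 3 * ENNReal.ofReal (K / 6 * x ^ s) := by
        gcongr <;> simp
    _ = ENNReal.ofReal (2 + 3 * (K / 6 * x ^ s)) := by
        rw [ENNReal.ofReal_add two_pos.le (by linarith), ENNReal.ofReal_mul three_pos.le,
          ENNReal.ofReal_ofNat, ENNReal.ofReal_ofNat]
    _ ≤ ENNReal.ofReal (K * x ^ s) := ENNReal.ofReal_le_ofReal (by linarith)

theorem le_lowerSpectralDim_of_geometric {a b : ℝ} (ha : 0 < a) (hb : 0 < b)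
    (h : ∀ᶠ n : ℕ in atTop, ∀ x, 4 * ((2 : ℝ) ^ a) ^ n ≤ x →
      ENNReal.ofReal ((2 ^ b) ^ n) ≤ 2 + 3 * countingFunction ν x) :
    ((b / a : ℝ) : EReal) ≤ lowerSpectralDim ν := by
  obtain ⟨N, hN⟩ := eventually_atTop.1 h
  have h2a : (1 : ℝ) < 2 ^ a := Real.one_lt_rpow one_lt_two ha
  refine le_lowerSpectralDim_of_eventually_le_add_mul (K := (4 ^ (b / a) * 2 ^ b)⁻¹)
    (div_pos hb ha) (by positivity) ?_
  filter_upwards [eventually_ge_atTop (4 * ((2 : ℝ) ^ a) ^ N)] with x hx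
  have hxN : ((2 : ℝ) ^ a) ^ N ≤ x / 4 := by rwa [le_div_iff₀' (by norm_num)]
  obtain ⟨n, hnx, hxn⟩ := exists_nat_pow_near ((one_le_pow₀ h2a.le).trans hxN) h2a
  have hNn : N ≤ n := Nat.lt_succ_iff.1 ((pow_lt_pow_iff_right₀ h2a).1 (hxN.trans_lt hxn))
  refine (ENNReal.ofReal_le_ofReal ?_).trans
    (hN n hNn x (by rwa [le_div_iff₀' (by norm_num)] at hnx))
  have hx0 : 0 < x / 4 := lt_of_lt_of_le (by positivity) hxN
  have hpow : (x / 4) ^ (b / a) ≤ (2 ^ b) ^ n * 2 ^ b := by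
    refine (Real.rpow_le_rpow hx0.le hxn.le (div_pos hb ha).le).trans_eq ?_
    rw [← pow_succ, ← Real.rpow_natCast, ← Real.rpow_natCast, ← Real.rpow_mul two_pos.le,
      ← Real.rpow_mul two_pos.le, ← Real.rpow_mul two_pos.le]
    congr 1
    field_simp
  rw [Real.div_rpow (by linarith) (by norm_num), div_le_iff₀' (by positivity)] at hpow
  rw [inv_mul_le_iff₀ (by positivity)]
  linarith

theorem half_le_lowerSpectralDim {q : ℝ} (hq : q ∈ Ioo (0 : ℝ) 1)
    (h : ∀ r < 1 - q, ∀ᶠ n : ℕ in atTop, (2 : ℝ) ^ (n * r) ≤ lqSum ν n q) :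
    ((1 / 2 : ℝ) : EReal) ≤ lowerSpectralDim ν := by
  have hlim : Tendsto (fun η : ℝ => (((1 - η) / (2 + η) : ℝ) : EReal)) (𝓝[>] 0)
      (𝓝 ((1 / 2 : ℝ) : EReal)) := by
    refine ((continuous_coe_real_ereal.tendsto _).comp ?_).mono_left nhdsWithin_le_nhds
    have hcont : ContinuousAt (fun η : ℝ => (1 - η) / (2 + η)) 0 := by
      fun_prop (disch := norm_num)
    simpa using hcont.tendsto
  refine le_of_tendsto hlim ?_
  filter_upwards [Ioo_mem_nhdsGT one_pos] with η hη
  refine le_lowerSpectralDim_of_geometric (by linarith [hη.1]) (sub_pos.2 hη.2) ?_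
  filter_upwards [eventually_rpow_le_card_heavyIndices hq h hη.1] with n hn x hx
  have hx0 : 0 < x := lt_of_lt_of_le (by positivity) hx
  have hθ : (4 * ((2 : ℝ) ^ (2 + η)) ^ n) * 2 ^ (-(n * (1 + η))) = 4 * 2 ^ n := by
    rw [← Real.rpow_mul_natCast two_pos.le, mul_assoc, ← Real.rpow_add two_pos, ← Real.rpow_natCast]
    ring_nf
  have hxθ : 2 * 2 ^ n < x * 2 ^ (-(n * (1 + η))) := by
    refine lt_of_lt_of_le ?_ (mul_le_mul_of_nonneg_right hx (by positivity))
    rw [hθ]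
    gcongr
    norm_num
  refine le_trans ?_ (card_heavyIndices_le_countingFunction hx0 hxθ)
  rw [← ENNReal.ofReal_natCast, ← Real.rpow_mul_natCast two_pos.le, mul_comm]
  exact ENNReal.ofReal_le_ofReal hn

theorem hasSpectralDim_half_of_tendsto_lqLevel {q : ℝ} (hq : q ∈ Ioo (0 : ℝ) 1)
    (h : Tendsto (fun n : ℕ => lqLevel ν n q) atTop (𝓝 ((1 - q : ℝ) : EReal))) :
    HasSpectralDim ν ((1 / 2 : ℝ) : EReal) := by
  have hlower : ((1 / 2 : ℝ) : EReal) ≤ lowerSpectralDim ν :=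
    half_le_lowerSpectralDim hq fun _ => eventually_rpow_le_lqSum_of_tendsto hq.1.le h
  have hle : lowerSpectralDim ν ≤ upperSpectralDim ν := liminf_le_limsup
  exact ⟨(hle.trans upperSpectralDim_le_half).antisymm hlower,
    upperSpectralDim_le_half.antisymm (hlower.trans hle)⟩

end LowerSpectralDim

end KreinFeller

end

theorem corollary1p4 (ν : Measure ℝ) [IsFiniteMeasure ν] (hν : ν (Ioo (0 : ℝ) 1)ᶜ = 0) :
    (KreinFeller.upperSpectralDim ν = ((1 / 2 : ℝ) : EReal) →
      ∀ q ∈ Icc (0 : ℝ) 1, KreinFeller.lqSpectrum ν q = ((1 - q : ℝ) : EReal)) ∧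
    (∀ q ∈ Ioo (0 : ℝ) 1,
      Tendsto (fun n : ℕ => KreinFeller.lqLevel ν n q) atTop (𝓝 (KreinFeller.lqSpectrum ν q)) →
      KreinFeller.lqSpectrum ν q = ((1 - q : ℝ) : EReal) →
        (∀ p ∈ Icc (0 : ℝ) 1, KreinFeller.lqSpectrum ν p = ((1 - p : ℝ) : EReal)) ∧
        KreinFeller.HasSpectralDim ν ((1 / 2 : ℝ) : EReal)) :=
  ⟨fun h _ hq => KreinFeller.lqSpectrum_eq_of_upperSpectralDim_eq_half h hq,
    fun _ hq hlim heq => ⟨fun _ hp => KreinFeller.lqSpectrum_eq_of_lqSpectrum_eq hq heq hp,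
      KreinFeller.hasSpectralDim_half_of_tendsto_lqLevel hq (heq ▸ hlim)⟩⟩
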